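/- Let $F$ be a number field of degree $n$ with ring of integers $\mathbb{Z}_F$, with $r_1$ real places and $r_2$ complex places. For an archimedean place $\sigma$ put $n_\sigma=1$ if $\sigma$ is real and $n_\sigma=2$ if it is complex, and fix for each complex place one of its two embeddings. Let $|\cdot|$ be the usual absolute value on $F_\sigma=\mathbb{R}$ or $\mathbb{C}$. For a prime $\mathfrak p$ let $\mathbb{Z}_{\mathfrak p}\subset F_{\mathfrak p}$ be the ring of integers of the completion and $v_{\mathfrak p}$ the normalized valuation. Let $\mathfrak m=\mathfrak m_f\mathfrak m_\infty$ be a modulus, i.e. a nonzero integral ideal $\mathfrak m_f$ and a set $\mathfrak m_\infty$ of real places. Put $(\mathbb{Z}_F/\mathfrak m)^\times=(\mathbb{Z}_F/\mathfrak m_f)^\times\times\prod_{\sigma\in\mathfrak m_\infty}\{\pm1\}$, $$U(\mathfrak m)=\prod_{\mathfrak p\mid\mathfrak m_f}(1+\mathfrak p^{v_{\mathfrak p}(\mathfrak m_f)}\mathbb{Z}_{\mathfrak p})\times\prod_{\mathfrak p\nmid\mathfrak m_f}\mathbb{Z}_{\mathfrak p}^\times\times\prod_{\sigma\in\mathfrak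 m_\infty}\{1\}\times\prod_{\sigma\notin\mathfrak m_\infty\text{ real}}\{\pm1\}\times\prod_{\sigma\text{ complex}}\{1\},$$ $C_{\mathfrak m}=\mathbb{A}_F^\times/(F^\times U(\mathfrak m))$ with the quotient topology, and let $\widehat C_{\mathfrak m}$ be its Pontryagin dual. Choose: a finite set $S$ of primes generating the class group; a uniformizer $\pi_{\mathfrak p}\in F_{\mathfrak p}$ for every prime $\mathfrak p$; an integer $r\ge0$, a full sublattice $\Lambda_{\mathfrak m}\subset\mathbb{Z}^{r}$ and an isomorphism $\log_{\mathfrak m}\colon(\mathbb{Z}_F/\mathfrak m)^\times\to\mathbb{Z}^r/\Lambda_{\mathfrak m}$. Put $\ell=|S|+r$. Let $U_S=\prod_{\mathfrak p\in S}F_{\mathfrak p}^\times\times\prod_{\mathfrak p\notin S}\mathbb{Z}_{\mathfrak p}^\times\times\prod_\sigma F_\sigma^\times$ and $\mathbb{Z}_{F,S}^\times=F^\times\cap U_S$. Write $\mathbb{Z}^\ell\times\mathbb{R}^n=(\mathbb{Z}^S\times\mathbb{Z}^r)\times(\mathbb{R}^{r_1+r_2}\times\mathbb{R}^{r_2})$,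 the last two factors being indexed by the archimedean places and by the complex places, and regard $\Lambda_{\mathfrak m}\subset\mathbb{Z}^r$ and $\mathbb{Z}^{r_2}\subset\mathbb{R}^{r_2}$ as subgroups of it. Define the homomorphism $\mathcal L_S\colon U_S\to(\mathbb{Z}^\ell\times\mathbb{R}^n)/(\Lambda_{\mathfrak m}+\mathbb{Z}^{r_2})$ by $$\mathcal L_S(x)=\Bigl((v_{\mathfrak p}(x_{\mathfrak p}))_{\mathfrak p\in S},\ \log_{\mathfrak m}\bigl(u\bmod\mathfrak m_f,(\operatorname{sgn}x_\sigma)_{\sigma\in\mathfrak m_\infty}\bigr),\ \bigl(\tfrac{n_\sigma}{2\pi}\log|x_\sigma|\bigr)_\sigma,\ \bigl(\tfrac{\arg x_\sigma}{2\pi}\bigr)_{\sigma\text{ complex}}\Bigr),\qquad u_{\mathfrak p}=x_{\mathfrak p}\pi_{\mathfrak p}^{-v_{\mathfrak p}(x_{\mathfrak p})},$$ and put $\Lambda=\mathcal L_S(\mathbb{Z}_{F,S}^\times)+\Lambda_{\mathfrak m}+\mathbb{Z}^{r_2}\subset\mathbb{Z}^\ell\times\mathbb{R}^n$. Let $\cdot$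 be the standard inner product on $\mathbb{R}^{\ell+n}$ and $\Lambda^\perp=\{w\in\mathbb{R}^{\ell+n}: w\cdot y\in\mathbb{Z}\text{ for all }y\in\Lambda\}$, which contains $\mathbb{Z}^\ell$. For $x\in\mathbb{A}_F^\times$ put $\mathcal L(x)=\mathcal L_S(x\alpha^{-1})\bmod\Lambda$, where $\alpha\in F^\times$ is such that $x\alpha^{-1}\in U_S$. For $\chi\in\widehat C_{\mathfrak m}$, with local components $\chi_\sigma(x)=\operatorname{sgn}(x)^{k_\sigma}|x|^{i\varphi_\sigma}$ ($k_\sigma\in\{0,1\}$) at real places and $\chi_\sigma(z)=(z/|z|)^{k_\sigma}|z|^{2i\varphi_\sigma}$ ($k_\sigma\in\mathbb{Z}$) at complex places, put $$\mathcal L^*(\chi)=\Bigl(\bigl(\tfrac{\arg\chi(\pi_{\mathfrak p})}{2\pi}\bigr)_{\mathfrak p\in S},\ \bigl(\tfrac{\arg\chi(\log_{\mathfrak m}^{-1}(g_i))}{2\pi}\bigr)_{1\le i\le r},\ (\varphi_\sigma)_\sigma,\ (k_\sigma)_{\sigma\text{ complex}}\Bigr)\in(\mathbb{R}/\mathbb{Z})^\ell\times\mathbb{R}^n,$$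 where $\pi_{\mathfrak p}$ is viewed as an idèle supported at $\mathfrak p$, $g_i$ is the image of the $i$-th standard basis vector of $\mathbb{Z}^r$, and $\chi(a)$ for $a\in(\mathbb{Z}_F/\mathfrak m)^\times$ is the value of $\chi$ at any idèle with components in $\mathbb{Z}_{\mathfrak p}^\times$ at all primes, $\pm1$ at real places and $1$ at complex places whose class in $(\mathbb{Z}_F/\mathfrak m)^\times$ is $a$. Then choices as above exist, and for every such choice: $\Lambda$ is a discrete subgroup of $\mathbb{Z}^\ell\times\mathbb{R}^n$, free of rank $\ell+n-1$; the maps $\mathcal L$ and $\mathcal L^*$ are well defined and induce isomorphisms of topological groups $$\mathcal L\colon C_{\mathfrak m}\xrightarrow{\ \sim\ }(\mathbb{Z}^\ell\times\mathbb{R}^n)/\Lambda,\qquad \mathcal L^*\colon\widehat C_{\mathfrak m}\xrightarrow{\ \sim\ }\Lambda^\perp/\mathbb{Z}^\ell;$$ and for all $\chi\in\widehat C_{\mathfrak m}$ and $x\in\mathbb{A}_F^\times$, $$\chi(x)=\exp\bigl(2i\pi\,\mathcal L^*(\chi)\cdot\mathcal L(x)\bigr).$$ -/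

import Mathlib

open NumberField IsDedekindDomain Topology
open scoped WithZero Multiplicative

noncomputable section

namespace HeckeLog

variable (F : Type*) [Field F] [NumberField F]

/-- The nonzero prime ideals of `F`. -/
abbrev Primes : Type _ := HeightOneSpectrum (𝓞 F)

/-- The group of idèles of `F`, i.e. the units of the adèle ring, with the topology of units. -/
abbrev Ideles : Type _ := (AdeleRing (𝓞 F) F)ˣ

/-- The complex places of `F`. -/
abbrev ComplexPlace : Type _ := {σ : InfinitePlace F // σ.IsComplex}

/-- The real places of `F`. -/
abbrev RealPlace : Type _ := {σ : InfinitePlace F // σ.IsReal}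

/-- A modulus: a nonzero integral ideal together with a set of real embeddings. -/
structure Modulus where
  /-- the finite part -/
  fin : Ideal (𝓞 F)
  fin_ne_bot : fin ≠ ⊥
  /-- the infinite part -/
  inf : Finset (RealPlace F)

variable {F}

/-! ### Components of idèles -/

/-- The component `x_𝔭` of an idèle at a prime ideal. -/
def finComp (p : Primes F) : Ideles F →* (p.adicCompletion F)ˣ :=
  Units.map { toFun := fun x => x.2 p, map_one' := rfl, map_mul' := fun _ _ => rfl }

/-- The component `x_σ` of an idèle at an archimedean place, in the completion `F_σ`. -/
def infComp (σ : InfinitePlace F) : Ideles F →* (σ.Completion)ˣ :=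
  Units.map { toFun := fun x => x.1 σ, map_one' := rfl, map_mul' := fun _ _ => rfl }

/-- The component `x_σ` at a real place, as a nonzero real number. -/
def realComp (σ : RealPlace F) : Ideles F →* ℝˣ :=
  (Units.map (InfinitePlace.Completion.extensionEmbeddingOfIsReal σ.2).toMonoidHom).comp
    (infComp σ.1)

/-- The component `x_σ` at a complex place, as a nonzero complex number; the place is identified
with the complex embedding `InfinitePlace.embedding`. -/
def complexComp (σ : ComplexPlace F) : Ideles F →* ℂˣ :=
  (Units.map (InfinitePlace.Completion.extensionEmbedding σ.1).toMonoidHom).comp (infComp σ.1)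

/-- The diagonal embedding `Fˣ → 𝔸_Fˣ`. -/
def principal : Fˣ →* Ideles F := Units.map (algebraMap F (AdeleRing (𝓞 F) F)).toMonoidHom

open scoped Classical in
/-- The idèle with component `z` at the prime `𝔭` and `1` at every other place. -/
def finEmb (p : Primes F) (z : (p.adicCompletion F)ˣ) : Ideles F where
  val := ((1 : InfiniteAdeleRing F),
    (RestrictedProduct.mulSingle (fun q : Primes F => q.adicCompletionIntegers F) p
      (z : p.adicCompletion F) : FiniteAdeleRing (𝓞 F) F))
  inv := ((1 : InfiniteAdeleRing F),
    (RestrictedProduct.mulSingle (fun q : Primes F => q.adicCompletionIntegers F) p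
      ((z⁻¹ : (p.adicCompletion F)ˣ) : p.adicCompletion F) : FiniteAdeleRing (𝓞 F) F))
  val_inv := by
    refine Prod.ext (mul_one _) ?_
    refine (RestrictedProduct.mulSingle_mul
      (fun q : Primes F => q.adicCompletionIntegers F) p _ _).symm.trans ?_
    rw [Units.mul_inv]
    exact RestrictedProduct.mulSingle_one _ p
  inv_val := by
    refine Prod.ext (mul_one _) ?_
    refine (RestrictedProduct.mulSingle_mul
      (fun q : Primes F => q.adicCompletionIntegers F) p _ _).symm.trans ?_
    rw [Units.inv_mul]
    exact RestrictedProduct.mulSingle_one _ p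

open scoped Classical in
/-- The idèle with component `z` at the archimedean place `σ` and `1` at every other place. -/
def infEmb (σ : InfinitePlace F) (z : (σ.Completion)ˣ) : Ideles F where
  val := ((Pi.mulSingle σ (z : σ.Completion) : InfiniteAdeleRing F),
    (1 : FiniteAdeleRing (𝓞 F) F))
  inv := ((Pi.mulSingle σ ((z⁻¹ : (σ.Completion)ˣ) : σ.Completion) : InfiniteAdeleRing F),
    (1 : FiniteAdeleRing (𝓞 F) F))
  val_inv := by
    refine Prod.ext ?_ (mul_one _)
    refine (Pi.mulSingle_mul (f := fun τ : InfinitePlace F => τ.Completion) σ _ _).symm.trans ?_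
    rw [Units.mul_inv]
    exact Pi.mulSingle_one σ
  inv_val := by
    refine Prod.ext ?_ (mul_one _)
    refine (Pi.mulSingle_mul (f := fun τ : InfinitePlace F => τ.Completion) σ _ _).symm.trans ?_
    rw [Units.inv_mul]
    exact Pi.mulSingle_one σ

/-- The normalized additive valuation `v_𝔭` on `F_𝔭ˣ`, with values in `ℤ`. -/
def ord (p : Primes F) (x : (p.adicCompletion F)ˣ) : ℤ :=
  -WithZero.log (Valued.v (x : p.adicCompletion F))

lemma ord_mul (p : Primes F) (x y : (p.adicCompletion F)ˣ) :
    ord p (x * y) = ord p x + ord p y := by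
  have hx : Valued.v (x : p.adicCompletion F) ≠ 0 := (Valuation.ne_zero_iff _).2 x.ne_zero
  have hy : Valued.v (y : p.adicCompletion F) ≠ 0 := (Valuation.ne_zero_iff _).2 y.ne_zero
  simp only [ord, Units.val_mul, map_mul, WithZero.log_mul hx hy]
  ring

/-! ### The ray class type group `C_𝔪` -/

/-- The exponent `v_𝔭(𝔪)` of the prime `𝔭` in the finite part of the modulus. -/
def Modulus.exponent (m : Modulus F) (p : Primes F) : ℕ := multiplicity p.asIdeal m.fin

/-- The group `U(𝔪)` of idèles congruent to `1` modulo `𝔪`: at a prime `𝔭` dividing `𝔪` the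
component lies in `1 + 𝔭 ^ v_𝔭(𝔪) ℤ_𝔭`, at the other primes in `ℤ_𝔭ˣ`, at real places
in `𝔪` it is `1`, at the other real places it is `±1`, and at complex places it is `1`. -/
def U (m : Modulus F) : Subgroup (Ideles F) where
  carrier := {x |
    (∀ p : Primes F, Valued.v (finComp p x : p.adicCompletion F) = 1 ∧
      Valued.v ((finComp p x : p.adicCompletion F) - 1) ≤ WithZero.exp (-(m.exponent p : ℤ))) ∧
    (∀ σ : RealPlace F, σ ∈ m.inf → realComp σ x = 1) ∧
    (∀ σ : RealPlace F, realComp σ x = 1 ∨ realComp σ x = -1) ∧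
    (∀ σ : ComplexPlace F, complexComp σ x = 1)}
  one_mem' := by
    refine ⟨fun p => ?_, fun σ _ => map_one _, fun σ => Or.inl (map_one _), fun σ => map_one _⟩
    rw [map_one]
    simp
  mul_mem' := by
    rintro x y ⟨hx, hx1, hx2, hx3⟩ ⟨hy, hy1, hy2, hy3⟩
    refine ⟨fun p => ⟨?_, ?_⟩, fun σ hσ => ?_, fun σ => ?_, fun σ => ?_⟩
    · rw [map_mul, Units.val_mul, map_mul, (hx p).1, (hy p).1, one_mul]
    · have h : (finComp p (x * y) : p.adicCompletion F) - 1 =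
          (finComp p x : p.adicCompletion F) * ((finComp p y : p.adicCompletion F) - 1) +
            ((finComp p x : p.adicCompletion F) - 1) := by
        rw [map_mul, Units.val_mul]; ring
      rw [h]
      refine (Valuation.map_add _ _ _).trans (max_le ?_ (hx p).2)
      rw [map_mul, (hx p).1, one_mul]
      exact (hy p).2
    · rw [map_mul, hx1 σ hσ, hy1 σ hσ, one_mul]
    · rw [map_mul]
      rcases hx2 σ with h | h <;> rcases hy2 σ with h' | h' <;> simp [h, h']
    · rw [map_mul, hx3 σ, hy3 σ, one_mul]
  inv_mem' := by
    rintro x ⟨hx, hx1, hx2, hx3⟩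
    refine ⟨fun p => ⟨?_, ?_⟩, fun σ hσ => ?_, fun σ => ?_, fun σ => ?_⟩
    · rw [map_inv, Units.val_inv_eq_inv_val, map_inv₀, (hx p).1, inv_one]
    · have h : (finComp p x⁻¹ : p.adicCompletion F) - 1 =
          -((finComp p x : p.adicCompletion F)⁻¹ * ((finComp p x : p.adicCompletion F) - 1)) := by
        rw [map_inv, Units.val_inv_eq_inv_val, mul_sub, inv_mul_cancel₀ (Units.ne_zero _)]
        ring
      rw [h, Valuation.map_neg, map_mul, map_inv₀, (hx p).1, inv_one, one_mul]
      exact (hx p).2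
    · rw [map_inv, hx1 σ hσ, inv_one]
    · rw [map_inv]
      rcases hx2 σ with h | h <;> simp [h]
    · rw [map_inv, hx3 σ, inv_one]

/-- `C_𝔪 = 𝔸_Fˣ / (Fˣ · U(𝔪))`, with the quotient topology. -/
abbrev C (m : Modulus F) : Type _ := Ideles F ⧸ ((principal (F := F)).range ⊔ U m)

/-- The class of an idèle in `C_𝔪`. -/
abbrev C.mk (m : Modulus F) (x : Ideles F) : C m := QuotientGroup.mk x

/-! ### Reduction modulo `𝔪` -/

/-- The ring `∏_𝔭 ℤ_𝔭`. -/
abbrev IntegralAdeles (F : Type*) [Field F] [NumberField F] : Type _ :=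
  ∀ p : Primes F, p.adicCompletionIntegers F

/-- The ideal `∏_𝔭 𝔭 ^ v_𝔭(𝔪) ℤ_𝔭` of `∏_𝔭 ℤ_𝔭`. -/
def modIdeal (m : Modulus F) : Ideal (IntegralAdeles F) where
  carrier := {u | ∀ p : Primes F,
    Valued.v (u p : p.adicCompletion F) ≤ WithZero.exp (-(m.exponent p : ℤ))}
  zero_mem' := fun p => by simp
  add_mem' := fun {u w} hu hw p => by
    exact (Valuation.map_add _ _ _).trans (max_le (hu p) (hw p))
  smul_mem' := fun c u hu p => by
    have h : Valued.v ((c • u) p : p.adicCompletion F) =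
      Valued.v (c p : p.adicCompletion F) * Valued.v (u p : p.adicCompletion F) := by
      rw [← map_mul]; rfl
    rw [h]
    exact (mul_le_of_le_one_left' (c p).2).trans (hu p)

/-- The map `ℤ_F → ∏_𝔭 ℤ_𝔭 / 𝔭 ^ v_𝔭(𝔪) ℤ_𝔭`. -/
def toResidue (m : Modulus F) : 𝓞 F →+* IntegralAdeles F ⧸ modIdeal m :=
  (Ideal.Quotient.mk (modIdeal m)).comp
    (RingHom.pi fun p : Primes F => algebraMap (𝓞 F) (p.adicCompletionIntegers F))

lemma ker_toResidue (m : Modulus F) : RingHom.ker (toResidue m) = m.fin := by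
  ext a
  have h1 : a ∈ RingHom.ker (toResidue m) ↔
      ∀ p : Primes F, a ∈ p.asIdeal ^ m.exponent p := by
    rw [RingHom.mem_ker, toResidue, RingHom.comp_apply, Ideal.Quotient.eq_zero_iff_mem]
    refine forall_congr' fun p => ?_
    rw [← HeightOneSpectrum.intValuation_le_pow_iff_mem,
      ← HeightOneSpectrum.valuation_of_algebraMap (K := F),
      ← HeightOneSpectrum.valuedAdicCompletion_eq_valuation']
    rfl
  rw [h1]
  conv_rhs => rw [← Ideal.iInf_maxPowDividing_eq (I := m.fin) m.fin_ne_bot]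
  simp only [Submodule.mem_iInf, Modulus.exponent,
    HeightOneSpectrum.maxPowDividing_eq_pow_multiplicity m.fin_ne_bot]

lemma isOpen_valued_lt (p : Primes F) (n : ℕ) :
    IsOpen {y : p.adicCompletion F | Valued.v y < WithZero.exp (-(n : ℤ))} := by
  obtain ⟨t, ht⟩ := HeightOneSpectrum.valuedAdicCompletion_surjective F p
    (WithZero.exp (-(n : ℤ)))
  have h : {y : p.adicCompletion F | Valued.v y < WithZero.exp (-(n : ℤ))} =
      {y : p.adicCompletion F | Valued.v.restrict y < Valued.v.restrict t} := by
    ext y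
    exact (by rw [ht]; exact Iff.rfl : _ ↔ Valued.v y < Valued.v t).trans
      (Valuation.restrict_lt_iff _).symm
  rw [h]
  exact Valued.isOpen_ball _ _

lemma exists_approx (p : Primes F) (x : p.adicCompletionIntegers F) (n : ℕ) :
    ∃ a : 𝓞 F, Valued.v ((x : p.adicCompletion F) -
      ((algebraMap (𝓞 F) F a : F) : p.adicCompletion F)) ≤ WithZero.exp (-(n : ℤ)) := by
  have hopen : IsOpen {y : p.adicCompletion F |
      Valued.v (y - (x : p.adicCompletion F)) < WithZero.exp (-(n : ℤ))} := by
    exact (isOpen_valued_lt p n).preimage (continuous_id.sub continuous_const)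
  obtain ⟨k, hk⟩ := (HeightOneSpectrum.denseRange_algebraMap F p).exists_mem_open hopen
    ⟨(x : p.adicCompletion F), by simp⟩
  have hk : Valued.v ((k : p.adicCompletion F) - (x : p.adicCompletion F)) <
    WithZero.exp (-(n : ℤ)) := hk
  have hk1 : p.valuation F k ≤ 1 := by
    rw [← HeightOneSpectrum.valuedAdicCompletion_eq_valuation']
    have h : (k : p.adicCompletion F) =
      ((k : p.adicCompletion F) - (x : p.adicCompletion F)) + (x : p.adicCompletion F) := by ring
    rw [h]
    refine (Valuation.map_add _ _ _).trans (max_le (hk.le.trans ?_) x.2)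
    rw [← WithZero.exp_zero, WithZero.exp_le_exp]
    omega
  obtain ⟨a, ha⟩ := HeightOneSpectrum.exists_valuation_sub_lt_of_integer p hk1
    (Units.mk0 (WithZero.exp (-(n : ℤ))) WithZero.exp_ne_zero)
  refine ⟨a, ?_⟩
  have ha' : Valued.v (((algebraMap (𝓞 F) F a : F) : p.adicCompletion F) -
      (k : p.adicCompletion F)) < WithZero.exp (-(n : ℤ)) := by
    have := HeightOneSpectrum.valuedAdicCompletion_eq_valuation' p (algebraMap (𝓞 F) F a - k)
    rw [← this] at ha
    rw [Units.val_mk0] at ha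
    convert ha using 2
    exact (map_sub (algebraMap F (p.adicCompletion F)) _ _).symm
  rw [Valuation.map_sub_swap]
  have h : ((algebraMap (𝓞 F) F a : F) : p.adicCompletion F) - (x : p.adicCompletion F) =
    (((algebraMap (𝓞 F) F a : F) : p.adicCompletion F) - (k : p.adicCompletion F)) +
    ((k : p.adicCompletion F) - (x : p.adicCompletion F)) := by ring
  rw [h]
  exact (Valuation.map_add _ _ _).trans (max_le ha'.le hk.le)

lemma toResidue_surjective (m : Modulus F) : Function.Surjective (toResidue m) := by
  intro c
  obtain ⟨u, rfl⟩ := Ideal.Quotient.mk_surjective c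
  choose a ha using fun p : Primes F => exists_approx p (u p) (m.exponent p)
  have hfin : {p : Primes F | p.asIdeal ∣ m.fin}.Finite := Ideal.finite_factors m.fin_ne_bot
  obtain ⟨y, hy⟩ := IsDedekindDomain.exists_forall_sub_mem_ideal (s := hfin.toFinset)
    (fun p : Primes F => p.asIdeal) m.exponent (fun p _ => p.prime)
    (fun p _ q _ hpq h => hpq (HeightOneSpectrum.ext h)) (fun p => a p.1)
  refine ⟨y, ?_⟩
  rw [toResidue, RingHom.comp_apply, Ideal.Quotient.mk_eq_mk_iff_sub_mem]
  intro p
  have h : ((algebraMap (𝓞 F) F y : F) : p.adicCompletion F) - (u p : p.adicCompletion F) =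
    ((algebraMap (𝓞 F) F (y - a p) : F) : p.adicCompletion F) -
    ((u p : p.adicCompletion F) - ((algebraMap (𝓞 F) F (a p) : F) : p.adicCompletion F)) := by
    have : ((algebraMap (𝓞 F) F (y - a p) : F) : p.adicCompletion F) =
      ((algebraMap (𝓞 F) F y : F) : p.adicCompletion F) -
      ((algebraMap (𝓞 F) F (a p) : F) : p.adicCompletion F) := by
      rw [map_sub]
      exact map_sub (algebraMap F (p.adicCompletion F)) _ _
    rw [this]; ring
  change Valued.v (((algebraMap (𝓞 F) F y : F) : p.adicCompletion F) -
    (u p : p.adicCompletion F)) ≤ _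
  rw [h]
  refine (Valuation.map_sub _ _ _).trans (max_le ?_ (ha p))
  rw [HeightOneSpectrum.valuedAdicCompletion_eq_valuation',
    HeightOneSpectrum.valuation_of_algebraMap, HeightOneSpectrum.intValuation_le_pow_iff_mem]
  by_cases hp : p.asIdeal ∣ m.fin
  · exact hy p (hfin.mem_toFinset.2 hp)
  · rw [Modulus.exponent, multiplicity_eq_zero.2 hp, pow_zero, Ideal.one_eq_top]
    exact Submodule.mem_top

/-- Reduction modulo the finite part of `𝔪`: the ring homomorphism `∏_𝔭 ℤ_𝔭 → ℤ_F / 𝔪_f` that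
sends `u` to the class of any `a ∈ ℤ_F` with `u_𝔭 ≡ a mod 𝔭 ^ v_𝔭(𝔪)` for all `𝔭`. -/
def reduction (m : Modulus F) : IntegralAdeles F →+* 𝓞 F ⧸ m.fin :=
  (((Ideal.quotEquivOfEq (ker_toResidue m).symm).trans
    (RingHom.quotientKerEquivOfSurjective (toResidue_surjective m))).symm : _ →+* _).comp
    (Ideal.Quotient.mk (modIdeal m))

/-- `(ℤ_F/𝔪)ˣ = (ℤ_F/𝔪_f)ˣ × ∏_{σ ∈ 𝔪_∞} {±1}`. -/
abbrev UnitsMod (m : Modulus F) : Type _ := (𝓞 F ⧸ m.fin)ˣ × (m.inf → ℤˣ)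

/-- The signs `(sgn x_σ)_{σ ∈ 𝔪_∞}` of an idèle. -/
def signs (m : Modulus F) : Ideles F →* (m.inf → ℤˣ) :=
  MonoidHom.pi fun σ =>
    (Units.map ((SignType.castHom : SignType →*₀ ℤ).comp
      (signHom : ℝ →*₀ SignType)).toMonoidHom).comp (realComp σ.1)

lemma arg_mul_circle {x y : ℂ} (hx : x ≠ 0) (hy : y ≠ 0) :
    ((Complex.arg (x * y) / (2 * Real.pi) : ℝ) : UnitAddCircle) =
      ((Complex.arg x / (2 * Real.pi) : ℝ) : UnitAddCircle) +
        ((Complex.arg y / (2 * Real.pi) : ℝ) : UnitAddCircle) := by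
  have h := Complex.arg_mul_coe_angle hx hy
  rw [← Real.Angle.coe_add, Real.Angle.angle_eq_iff_two_pi_dvd_sub] at h
  obtain ⟨k, hk⟩ := h
  have hpi := Real.pi_ne_zero
  have h2 : Complex.arg (x * y) / (2 * Real.pi) =
      Complex.arg x / (2 * Real.pi) + Complex.arg y / (2 * Real.pi) + k := by
    field_simp
    linarith
  rw [h2, AddCircle.coe_add, AddCircle.coe_add]
  have h3 : ((k : ℝ) : UnitAddCircle) = 0 := by
    rw [AddCircle.coe_eq_zero_iff]
    exact ⟨k, by simp⟩
  rw [h3, add_zero]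

/-! ### The choices, and the logarithm -/

/-- The choices on which the logarithm maps depend. -/
structure LogData (m : Modulus F) where
  /-- a finite set of primes generating the class group -/
  S : Finset (Primes F)
  S_generates : Subgroup.closure
    ((fun p : Primes F => ClassGroup.mk0
      ⟨p.asIdeal, mem_nonZeroDivisors_of_ne_zero p.ne_bot⟩) '' (S : Set (Primes F))) = ⊤
  /-- a uniformizer `π_𝔭` of `F_𝔭` for every prime `𝔭` -/
  unif : ∀ p : Primes F, (p.adicCompletion F)ˣ
  ord_unif : ∀ p, ord p (unif p) = 1
  /-- the number `r(𝔪)` of generators -/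
  r : ℕ
  /-- the full sublattice `Λ_𝔪` of `ℤ^{r(𝔪)}` -/
  relations : AddSubgroup (Fin r → ℤ)
  relations_full : relations.FiniteIndex
  /-- the isomorphism `log_𝔪 : (ℤ_F/𝔪)ˣ ≅ ℤ^{r(𝔪)}/Λ_𝔪` -/
  logMod : UnitsMod m ≃* Multiplicative ((Fin r → ℤ) ⧸ relations)

namespace LogData

variable {m : Modulus F} (D : LogData m)

/-- The group `U_S` of `S`-idèles. -/
def US : Subgroup (Ideles F) where
  carrier := {x | ∀ p : Primes F, p ∉ D.S → Valued.v (finComp p x : p.adicCompletion F) = 1}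
  one_mem' := fun p _ => by simp
  mul_mem' := fun {x y} hx hy p hp => by
    rw [map_mul, Units.val_mul, map_mul, hx p hp, hy p hp, one_mul]
  inv_mem' := fun {x} hx p hp => by
    rw [map_inv, Units.val_inv_eq_inv_val, map_inv₀, hx p hp, inv_one]

/-- The group `ℤ_{F,S}ˣ = Fˣ ∩ U_S` of `S`-units. -/
def sUnits : Subgroup Fˣ := D.US.comap principal

lemma valued_unitPart (p : Primes F) (x : (p.adicCompletion F)ˣ) :
    Valued.v ((x * D.unif p ^ (-ord p x) : (p.adicCompletion F)ˣ) : p.adicCompletion F) = 1 := by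
  have hx : Valued.v (x : p.adicCompletion F) ≠ 0 := (Valuation.ne_zero_iff _).2 x.ne_zero
  have hπ : Valued.v (D.unif p : p.adicCompletion F) ≠ 0 :=
    (Valuation.ne_zero_iff _).2 (D.unif p).ne_zero
  have h1 : WithZero.log (Valued.v (D.unif p : p.adicCompletion F)) = -1 := by
    have := D.ord_unif p
    unfold ord at this
    omega
  rw [Units.val_mul, map_mul, Units.val_zpow_eq_zpow_val, map_zpow₀]
  have hz : Valued.v (x : p.adicCompletion F) *
      Valued.v (D.unif p : p.adicCompletion F) ^ (-ord p x) ≠ 0 :=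
    mul_ne_zero hx (zpow_ne_zero _ hπ)
  rw [← WithZero.exp_log hz, WithZero.log_mul hx (zpow_ne_zero _ hπ), WithZero.log_zpow, h1]
  simp [ord]

/-- The unit part `x ↦ x π_𝔭 ^ (-v_𝔭(x))` on `F_𝔭ˣ`. -/
def unitPart (p : Primes F) : (p.adicCompletion F)ˣ →* (p.adicCompletionIntegers F)ˣ :=
  MonoidHom.toHomUnits
    { toFun := fun x => ⟨(x * D.unif p ^ (-ord p x) : (p.adicCompletion F)ˣ),
        (D.valued_unitPart p x).le⟩
      map_one' := by
        refine Subtype.ext ?_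
        simp [ord]
      map_mul' := fun x y => by
        refine Subtype.ext ?_
        have h : x * y * D.unif p ^ (-ord p (x * y)) =
            x * D.unif p ^ (-ord p x) * (y * D.unif p ^ (-ord p y)) := by
          rw [ord_mul, neg_add, zpow_add, mul_mul_mul_comm]
        exact (congrArg Units.val h).trans (Units.val_mul _ _) }

/-- The class in `(ℤ_F/𝔪)ˣ` of an idèle `x`: the reduction modulo `𝔪_f` of the family
`u_𝔭 = x_𝔭 π_𝔭 ^ (-v_𝔭(x_𝔭))`, and the signs of `x` at the places of `𝔪_∞`. -/
def residue : Ideles F →* UnitsMod m :=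
  MonoidHom.prod
    ((Units.map (reduction m).toMonoidHom).comp
      ((MulEquiv.piUnits (M := fun p : Primes F => p.adicCompletionIntegers F)).symm.toMonoidHom.comp
        (MonoidHom.pi fun p : Primes F => (D.unitPart p).comp (finComp p))))
    (signs m)

/-- The number `ℓ = |S| + r(𝔪)`. -/
def ell : ℕ := D.S.card + D.r

/-- The group `ℤ^ℓ × ℝ^n`, with its coordinates written in blocks: `ℤ^ℓ = ℤ^S × ℤ^{r(𝔪)}`, and
`ℝ^n = ℝ^{r₁+r₂} × ℝ^{r₂}` is indexed by the archimedean places and the complex places. -/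
abbrev M : Type _ :=
  ((D.S → ℤ) × (Fin D.r → ℤ)) × ((InfinitePlace F → ℝ) × (ComplexPlace F → ℝ))

/-- The space `ℝ^{ℓ+n}`, with the same blocks of coordinates. -/
abbrev V : Type _ :=
  ((D.S → ℝ) × (Fin D.r → ℝ)) × ((InfinitePlace F → ℝ) × (ComplexPlace F → ℝ))

/-- The group `(ℤ^ℓ × ℝ^n)/(Λ_𝔪 + ℤ^{r₂})`, written as the product of its blocks. -/
abbrev MQuot : Type _ :=
  ((D.S → ℤ) × ((Fin D.r → ℤ) ⧸ D.relations)) ×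
    ((InfinitePlace F → ℝ) × (ComplexPlace F → UnitAddCircle))

/-- The projection `ℤ^ℓ × ℝ^n → (ℤ^ℓ × ℝ^n)/(Λ_𝔪 + ℤ^{r₂})`. -/
def proj : D.M →+ D.MQuot :=
  ((AddMonoidHom.id _).prodMap (QuotientAddGroup.mk' D.relations)).prodMap
    ((AddMonoidHom.id _).prodMap
      ((QuotientAddGroup.mk' (AddSubgroup.zmultiples (1 : ℝ))).compLeft (ComplexPlace F)))

/-- The logarithm `ℒ_S`, with components `v_𝔭(x_𝔭)` for `𝔭 ∈ S`, `log_𝔪` of the class of `x` in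
`(ℤ_F/𝔪)ˣ`, `n_σ/(2π) · log |x_σ|` for all archimedean `σ`, and `arg(x_σ)/(2π)` for `σ` complex.
The formula is a homomorphism on all idèles; `ℒ_S` is its restriction to `U_S`. -/
def logS : Ideles F →* Multiplicative D.MQuot where
  toFun x := Multiplicative.ofAdd
    ((fun p => ord p.1 (finComp p.1 x), (D.logMod (D.residue x)).toAdd),
      (fun σ => (σ.mult : ℝ) / (2 * Real.pi) * Real.log ‖(infComp σ x : σ.Completion)‖,
       fun σ => ((Complex.arg (complexComp σ x : ℂ) / (2 * Real.pi) : ℝ) : UnitAddCircle)))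
  map_one' := by
    refine congrArg Multiplicative.ofAdd (Prod.ext (Prod.ext ?_ ?_) (Prod.ext ?_ ?_))
    · funext p
      simp [ord]
    · simp
    · funext σ
      simp
    · funext σ
      simp
  map_mul' x y := by
    refine congrArg Multiplicative.ofAdd (Prod.ext (Prod.ext ?_ ?_) (Prod.ext ?_ ?_))
    · funext p
      simp only [map_mul, ord_mul]
      rfl
    · simp only [map_mul, toAdd_mul]
      rfl
    · funext σ
      have hx : ‖(infComp σ x : σ.Completion)‖ ≠ 0 := norm_ne_zero_iff.2 (Units.ne_zero _)
      have hy : ‖(infComp σ y : σ.Completion)‖ ≠ 0 := norm_ne_zero_iff.2 (Units.ne_zero _)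
      simp only [map_mul, Units.val_mul, norm_mul, Real.log_mul hx hy, mul_add]
      rfl
    · funext σ
      simp only [map_mul, Units.val_mul]
      exact arg_mul_circle (Units.ne_zero _) (Units.ne_zero _)

/-- `Λ = ℒ_S(ℤ_{F,S}ˣ) + Λ_𝔪 + ℤ^{r₂}`, as a subgroup of `ℤ^ℓ × ℝ^n`: the elements whose class
modulo `Λ_𝔪 + ℤ^{r₂}` belongs to `ℒ_S(ℤ_{F,S}ˣ)`. -/
def Lam : AddSubgroup D.M :=
  (Subgroup.toAddSubgroup' (D.sUnits.map (D.logS.comp principal))).comap D.proj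

open scoped Classical in
/-- The standard inner product between `ℝ^{ℓ+n}` and its subgroup `ℤ^ℓ × ℝ^n`. -/
def pairing (w : D.V) (y : D.M) : ℝ :=
  ((∑ p, w.1.1 p * (y.1.1 p : ℝ)) + ∑ i, w.1.2 i * (y.1.2 i : ℝ)) +
    ((∑ σ, w.2.1 σ * y.2.1 σ) + ∑ σ, w.2.2 σ * y.2.2 σ)

/-- The Pontryagin orthogonal `Λ^⊥` of `Λ` in `ℝ^{ℓ+n}`. -/
def LamPerp : AddSubgroup D.V where
  carrier := {w | ∀ y ∈ D.Lam, ∃ k : ℤ, D.pairing w y = k}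
  zero_mem' := fun y _ => ⟨0, by simp [pairing]⟩
  add_mem' := fun {w w'} hw hw' y hy => by
    obtain ⟨k, hk⟩ := hw y hy
    obtain ⟨k', hk'⟩ := hw' y hy
    refine ⟨k + k', ?_⟩
    rw [Int.cast_add, ← hk, ← hk']
    simp only [pairing, Prod.fst_add, Prod.snd_add, Pi.add_apply, add_mul,
      Finset.sum_add_distrib]
    ring
  neg_mem' := fun {w} hw y hy => by
    obtain ⟨k, hk⟩ := hw y hy
    refine ⟨-k, ?_⟩
    rw [Int.cast_neg, ← hk]
    simp only [pairing, Prod.fst_neg, Prod.snd_neg, Pi.neg_apply, neg_mul,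
      Finset.sum_neg_distrib]
    ring

/-- The subgroup `ℤ^ℓ` of `ℝ^{ℓ+n}`. -/
def ZEll : AddSubgroup D.V :=
  (AddMonoidHom.range ((AddMonoidHom.compLeft (Int.castAddHom ℝ) D.S).prodMap
    (AddMonoidHom.compLeft (Int.castAddHom ℝ) (Fin D.r)))).prod ⊥

lemma ZEll_le_LamPerp : D.ZEll ≤ D.LamPerp := by
  rintro ⟨a, b⟩ ⟨⟨⟨c, d⟩, rfl⟩, hb⟩ y -
  obtain rfl : b = 0 := hb
  refine ⟨(∑ p, c p * y.1.1 p) + ∑ i, d i * y.1.2 i, ?_⟩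
  simp [pairing]

/-- The group `Λ^⊥ / ℤ^ℓ`, with the quotient topology. -/
abbrev LamPerpQuot : Type _ := D.LamPerp ⧸ D.ZEll.addSubgroupOf D.LamPerp

/-- `φ` is the parameter at the real place `σ` of the character `χ` of `C_𝔪`: for some
`k ∈ {0,1}`, the local component is `χ_σ(x) = sgn(x)^k |x|^{iφ}`. -/
def IsRealParam (χ : PontryaginDual (C m)) (σ : RealPlace F) (φ : ℝ) : Prop :=
  ∃ k : ℕ, k ≤ 1 ∧ ∀ z : (σ.1.Completion)ˣ,
    let x : ℝ := InfinitePlace.Completion.extensionEmbeddingOfIsReal σ.2 z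
    (χ (C.mk m (infEmb σ.1 z)) : ℂ) =
      ((SignType.sign x : ℝ) : ℂ) ^ k * ((|x| : ℝ) : ℂ) ^ (Complex.I * φ)

/-- `(k, φ)` are the parameters at the complex place `σ` of the character `χ` of `C_𝔪`: the local
component is `χ_σ(z) = (z/|z|)^k |z|^{2iφ}`. -/
def IsComplexParam (χ : PontryaginDual (C m)) (σ : ComplexPlace F) (k : ℤ) (φ : ℝ) : Prop :=
  ∀ z : (σ.1.Completion)ˣ,
    let x : ℂ := InfinitePlace.Completion.extensionEmbedding σ.1 z
    (χ (C.mk m (infEmb σ.1 z)) : ℂ) =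
      (x / (‖x‖ : ℂ)) ^ k * (‖x‖ : ℂ) ^ (2 * Complex.I * φ)

/-- `u` is an idèle representing the element `a` of `(ℤ_F/𝔪)ˣ`: its components are units at all
primes, `±1` at the real places and `1` at the complex places, and its class
in `(ℤ_F/𝔪)ˣ` is `a`. -/
def Represents (u : Ideles F) (a : UnitsMod m) : Prop :=
  (∀ p : Primes F, Valued.v (finComp p u : p.adicCompletion F) = 1) ∧
  (∀ σ : RealPlace F, realComp σ u = 1 ∨ realComp σ u = -1) ∧
  (∀ σ : ComplexPlace F, complexComp σ u = 1) ∧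
  D.residue u = a

/-- The vector `w ∈ ℝ^{ℓ+n}` represents the dual logarithm `ℒ*(χ) ∈ (ℝ/ℤ)^ℓ × ℝ^n`: its
coordinates are `arg χ(𝔭)/(2π)` modulo `ℤ` for `𝔭 ∈ S` (with `χ(𝔭) = χ(π_𝔭)`),
`arg χ(log_𝔪⁻¹(g_i))/(2π)` modulo `ℤ`, where `g_i` is the image of the `i`-th standard basis vector
of `ℤ^{r(𝔪)}`, then the `φ_σ` for all archimedean `σ`, and the `k_σ` for `σ` complex. -/
structure IsDualLog (χ : PontryaginDual (C m)) (w : D.V) : Prop where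
  prime : ∀ p : D.S, (w.1.1 p : UnitAddCircle) =
    ((Complex.arg (χ (C.mk m (finEmb p.1 (D.unif p.1))) : ℂ) / (2 * Real.pi) : ℝ) : UnitAddCircle)
  modulus : ∀ i : Fin D.r, ∃ u : Ideles F,
    D.Represents u (D.logMod.symm (Multiplicative.ofAdd
      (QuotientAddGroup.mk (Pi.single i (1 : ℤ)) : (Fin D.r → ℤ) ⧸ D.relations))) ∧
    (w.1.2 i : UnitAddCircle) =
      ((Complex.arg (χ (C.mk m u) : ℂ) / (2 * Real.pi) : ℝ) : UnitAddCircle)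
  real : ∀ σ : RealPlace F, IsRealParam χ σ (w.2.1 σ.1)
  complex : ∀ σ : ComplexPlace F, ∃ k : ℤ, w.2.2 σ = k ∧ IsComplexParam χ σ k (w.2.1 σ.1)

end LogData

end HeckeLog

end

/-!
The logarithm `ℒ_S` and its kernel carry the whole argument.

*The isomorphism `ℒ`.* On `U_S`, the kernel of `ℒ_S` is exactly `U(𝔪)`
(`LogData.logS_eq_one_iff_mem_U`), and `ℒ_S` maps `U_S` onto `(ℤ^ℓ × ℝ^n)/(Λ_𝔪 + ℤ^{r₂})`
(`LogData.exists_logS_eq`): uniformizers, representatives of `(ℤ_F/𝔪)ˣ` and archimedean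
exponentials give all the coordinates. Since `S` generates the class group, every idèle is the
product of an element of `U_S` and a principal idèle (`LogData.exists_mul_principal_inv_mem_US`).
Hence choosing preimages under `ℒ_S` defines a surjective homomorphism
`LogData.expC : ℤ^ℓ × ℝ^n → C_𝔪` whose kernel is `Λ`, and `ℒ` is the inverse of the induced
isomorphism. Both directions are continuous because near the identity they only involve the
archimedean exponential and logarithm.

*The lattice `Λ`.* An element of `Λ` near `0` comes from a unit with bounded conjugates, and there
are finitely many of these, so `Λ` is discrete. Its rank is computed along the filtration given by
the valuations at `S` (rank `|S|`, because some power of every prime is principal), the logarithms of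
absolute values of units (rank `r₁ + r₂ - 1`, by Dirichlet's unit theorem), and the remaining part,
which contains `Λ_𝔪 + ℤ^{r₂}` with finite exponent (rank `r + r₂`).

*The isomorphism `ℒ*`.* Every continuous character of `ℤ^ℓ × ℝ^n` has the form
`y ↦ exp (2πi w·y)` (`LogData.exists_eq_pairChar`), it is trivial on `Λ` if and only if `w ∈ Λ^⊥`,
and it is trivial if and only if `w ∈ ℤ^ℓ`. Composing with `ℒ` yields a continuous surjection from
`Λ^⊥` to the dual of `C_𝔪`, with kernel `ℤ^ℓ`, which is open by the open mapping theorem for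
`σ`-compact groups; `ℒ*` is the inverse of the induced isomorphism. Evaluating the character of `w`
on uniformizers, on representatives of `(ℤ_F/𝔪)ˣ` and on archimedean components shows that `w`
satisfies the formulas which define the dual logarithm, and these formulas determine `w` modulo
`ℤ^ℓ` (`LogData.isDualLog_iff`).
-/

set_option linter.unusedSectionVars false

noncomputable section

namespace HeckeLog

variable {F : Type*} [Field F] [NumberField F]

/-! ### Idèles with unit components -/

lemma ord_eq_zero_iff (p : Primes F) (x : (p.adicCompletion F)ˣ) :
    ord p x = 0 ↔ Valued.v (x : p.adicCompletion F) = 1 := by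
  have hx : Valued.v (x : p.adicCompletion F) ≠ 0 := (Valuation.ne_zero_iff _).2 x.ne_zero
  rw [ord, neg_eq_zero]
  constructor
  · intro h
    rw [← WithZero.exp_log hx, h, WithZero.exp_zero]
  · intro h
    rw [h, WithZero.log_one]

lemma ord_one (p : Primes F) : ord p 1 = 0 := by
  rw [ord_eq_zero_iff]; simp

/-- The valuation `v_𝔭` as a homomorphism `F_𝔭ˣ → ℤ`. -/
def ordHom (p : Primes F) : (p.adicCompletion F)ˣ →* Multiplicative ℤ where
  toFun x := Multiplicative.ofAdd (ord p x)
  map_one' := by rw [ord_one]; rfl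
  map_mul' x y := by rw [ord_mul]; rfl

lemma ord_inv (p : Primes F) (x : (p.adicCompletion F)ˣ) : ord p x⁻¹ = -ord p x :=
  congrArg Multiplicative.toAdd (map_inv (ordHom p) x)

lemma valued_intUnit (p : Primes F) (u : (p.adicCompletionIntegers F)ˣ) :
    Valued.v ((u : p.adicCompletionIntegers F) : p.adicCompletion F) = 1 :=
  HeightOneSpectrum.adicCompletionIntegers.isUnit_iff_valued_eq_one.1 u.isUnit

/-- The idèle with prescribed nonzero archimedean components and prescribed units at all primes. -/
def localIdele : (∀ σ : InfinitePlace F, (σ.Completion)ˣ) ×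
    (∀ p : Primes F, (p.adicCompletionIntegers F)ˣ) →* Ideles F :=
  MonoidHom.toHomUnits
    { toFun := fun zu => ((fun σ => (zu.1 σ : σ.Completion) : InfiniteAdeleRing F),
        (RestrictedProduct.structureMap (fun p : Primes F => p.adicCompletion F)
          (fun p => (p.adicCompletionIntegers F : Set (p.adicCompletion F))) Filter.cofinite
          (fun p => (zu.2 p : p.adicCompletionIntegers F)) : FiniteAdeleRing (𝓞 F) F))
      map_one' := rfl
      map_mul' := fun _ _ => rfl }


@[simp] lemma coe_finComp_localIdele (zu) (p : Primes F) :
    (finComp p (localIdele zu) : p.adicCompletion F) =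
      ((zu.2 p : p.adicCompletionIntegers F) : p.adicCompletion F) := rfl

lemma valued_finComp_localIdele (zu) (p : Primes F) :
    Valued.v (finComp p (localIdele zu) : p.adicCompletion F) = 1 :=
  valued_intUnit p (zu.2 p)

@[simp] lemma infComp_localIdele (zu) (σ : InfinitePlace F) :
    infComp σ (localIdele zu) = zu.1 σ := Units.ext rfl

lemma finComp_finEmb_self (p : Primes F) (z : (p.adicCompletion F)ˣ) :
    finComp p (finEmb p z) = z := by
  classical
  refine Units.ext ?_
  exact RestrictedProduct.mulSingle_eq_same
    (A := fun q : Primes F => q.adicCompletionIntegers F) p _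

lemma finComp_finEmb_of_ne {p q : Primes F} (h : q ≠ p) (z : (p.adicCompletion F)ˣ) :
    finComp q (finEmb p z) = 1 := by
  classical
  refine Units.ext ?_
  exact RestrictedProduct.mulSingle_eq_of_ne
    (A := fun q : Primes F => q.adicCompletionIntegers F) _ h

lemma infComp_finEmb (p : Primes F) (z : (p.adicCompletion F)ˣ) (σ : InfinitePlace F) :
    infComp σ (finEmb p z) = 1 := Units.ext rfl

lemma finComp_infEmb (σ : InfinitePlace F) (z : (σ.Completion)ˣ) (p : Primes F) :
    finComp p (infEmb σ z) = 1 := Units.ext rfl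

lemma infComp_infEmb_self (σ : InfinitePlace F) (z : (σ.Completion)ˣ) :
    infComp σ (infEmb σ z) = z := by
  classical
  exact Units.ext (Pi.mulSingle_eq_same (M := fun τ : InfinitePlace F => τ.Completion) σ _)

lemma infComp_infEmb_of_ne {σ τ : InfinitePlace F} (h : τ ≠ σ) (z : (σ.Completion)ˣ) :
    infComp τ (infEmb σ z) = 1 := by
  classical
  exact Units.ext (Pi.mulSingle_eq_of_ne (M := fun τ : InfinitePlace F => τ.Completion) h _)

lemma norm_infComp_real (σ : RealPlace F) (x : Ideles F) :
    ‖(infComp σ.1 x : σ.1.Completion)‖ = |(realComp σ x : ℝ)| := by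
  have := (InfinitePlace.Completion.isometry_extensionEmbeddingOfIsReal σ.2).norm_map_of_map_zero
    (map_zero _) (infComp σ.1 x : σ.1.Completion)
  rw [← this, Real.norm_eq_abs]; rfl

lemma norm_infComp_complex (σ : ComplexPlace F) (x : Ideles F) :
    ‖(infComp σ.1 x : σ.1.Completion)‖ = ‖(complexComp σ x : ℂ)‖ := by
  have := (InfinitePlace.Completion.isometry_extensionEmbedding σ.1).norm_map_of_map_zero
    (map_zero _) (infComp σ.1 x : σ.1.Completion)
  rw [← this]; rfl

lemma finComp_principal (p : Primes F) (α : Fˣ) :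
    (finComp p (principal α) : p.adicCompletion F) = ((α : F) : p.adicCompletion F) := rfl

lemma infComp_principal (σ : InfinitePlace F) (α : Fˣ) :
    (infComp σ (principal α) : σ.Completion) = ((α : F) : σ.Completion) := rfl

lemma valued_finComp_principal (p : Primes F) (α : Fˣ) :
    Valued.v (finComp p (principal α) : p.adicCompletion F) = p.valuation F (α : F) := by
  rw [finComp_principal, HeightOneSpectrum.valuedAdicCompletion_eq_valuation']

lemma norm_infComp_principal (σ : InfinitePlace F) (α : Fˣ) :
    ‖(infComp σ (principal α) : σ.Completion)‖ = σ (α : F) := by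
  rw [infComp_principal]
  exact InfinitePlace.Completion.norm_coe (v := σ) ((WithAbs.equiv σ.1).symm (α : F))

/-! ### The kernel of the logarithm -/

/-- The isomorphism through which `reduction` is defined. -/
def residueEquiv (m : Modulus F) : (IntegralAdeles F ⧸ modIdeal m) ≃+* 𝓞 F ⧸ m.fin :=
  ((Ideal.quotEquivOfEq (ker_toResidue m).symm).trans
    (RingHom.quotientKerEquivOfSurjective (toResidue_surjective m))).symm

lemma reduction_apply (m : Modulus F) (u : IntegralAdeles F) :
    reduction m u = residueEquiv m (Ideal.Quotient.mk (modIdeal m) u) := rfl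

lemma reduction_surjective (m : Modulus F) : Function.Surjective (reduction m) :=
  (residueEquiv m).surjective.comp Ideal.Quotient.mk_surjective

lemma reduction_eq_iff (m : Modulus F) (u v : IntegralAdeles F) :
    reduction m u = reduction m v ↔ u - v ∈ modIdeal m := by
  rw [← Ideal.Quotient.mk_eq_mk_iff_sub_mem]
  rw [reduction_apply, reduction_apply, (residueEquiv m).injective.eq_iff]

lemma mem_modIdeal {m : Modulus F} {u : IntegralAdeles F} : u ∈ modIdeal m ↔
    ∀ p : Primes F, Valued.v (u p : p.adicCompletion F) ≤ WithZero.exp (-(m.exponent p : ℤ)) :=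
  Iff.rfl

lemma signs_apply_eq_one_iff (m : Modulus F) (x : Ideles F) (σ : m.inf) :
    signs m x σ = 1 ↔ 0 < (realComp σ.1 x : ℝ) := by
  rw [← Units.val_inj]
  change ((SignType.sign (realComp σ.1 x : ℝ) : SignType) : ℤ) = 1 ↔ _
  have h0 : (realComp σ.1 x : ℝ) ≠ 0 := Units.ne_zero _
  rcases h0.lt_or_gt with h | h
  · simp [sign_neg h, h.not_gt]
  · simp [sign_pos h, h]

namespace LogData

variable {m : Modulus F} (D : LogData m)

lemma coe_unitPart_of_ord_eq_zero (p : Primes F) (x : (p.adicCompletion F)ˣ) (h : ord p x = 0) :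
    ((D.unitPart p x : p.adicCompletionIntegers F) : p.adicCompletion F) = x := by
  change ((x * D.unif p ^ (-ord p x) : (p.adicCompletion F)ˣ) : p.adicCompletion F) = x
  rw [h]; simp

lemma residue_fst_eq_one_iff (x : Ideles F) : (D.residue x).1 = 1 ↔
    ∀ p, Valued.v (((D.unitPart p (finComp p x) : p.adicCompletionIntegers F) :
      p.adicCompletion F) - 1) ≤ WithZero.exp (-(m.exponent p : ℤ)) := by
  rw [← Units.val_inj]
  change reduction m (fun p => (D.unitPart p (finComp p x) : p.adicCompletionIntegers F)) = 1 ↔ _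
  rw [← map_one (reduction m), reduction_eq_iff, mem_modIdeal]
  rfl

lemma residue_snd (x : Ideles F) : (D.residue x).2 = signs m x := rfl

lemma residue_eq_one_iff_of_units {x : Ideles F}
    (hx : ∀ p, Valued.v (finComp p x : p.adicCompletion F) = 1) : D.residue x = 1 ↔
    (∀ p, Valued.v ((finComp p x : p.adicCompletion F) - 1) ≤
      WithZero.exp (-(m.exponent p : ℤ))) ∧ ∀ σ ∈ m.inf, 0 < (realComp σ x : ℝ) := by
  rw [Prod.ext_iff, residue_snd]
  refine and_congr ?_ ?_
  · refine (D.residue_fst_eq_one_iff x).trans (forall_congr' fun p => ?_)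
    rw [D.coe_unitPart_of_ord_eq_zero p _ ((ord_eq_zero_iff _ _).2 (hx p))]
  · rw [funext_iff]
    simp only [Prod.snd_one, Pi.one_apply, signs_apply_eq_one_iff, Subtype.forall]

lemma units_of_mem_US {x : Ideles F} (hx : x ∈ D.US) (h : ∀ p : D.S, ord p.1 (finComp p.1 x) = 0)
    (p : Primes F) : Valued.v (finComp p x : p.adicCompletion F) = 1 := by
  by_cases hp : p ∈ D.S
  · exact (ord_eq_zero_iff _ _).1 (h ⟨p, hp⟩)
  · exact hx p hp

lemma logS_apply (x : Ideles F) : D.logS x = Multiplicative.ofAdd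
    (((fun p => ord p.1 (finComp p.1 x), (D.logMod (D.residue x)).toAdd),
      (fun σ => (σ.mult : ℝ) / (2 * Real.pi) * Real.log ‖(infComp σ x : σ.Completion)‖,
       fun σ => ((Complex.arg (complexComp σ x : ℂ) / (2 * Real.pi) : ℝ) : UnitAddCircle))) :
      D.MQuot) := rfl

lemma logS_eq_one_iff (x : Ideles F) : D.logS x = 1 ↔
    ((∀ p : D.S, ord p.1 (finComp p.1 x) = 0) ∧ D.residue x = 1) ∧
      (∀ σ, ‖(infComp σ x : σ.Completion)‖ = 1) ∧
      ∀ σ : ComplexPlace F,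
        ((Complex.arg (complexComp σ x : ℂ) / (2 * Real.pi) : ℝ) : UnitAddCircle) = 0 := by
  rw [logS_apply, ← ofAdd_zero, Multiplicative.ofAdd.apply_eq_iff_eq, Prod.ext_iff, Prod.ext_iff,
    Prod.ext_iff, funext_iff, funext_iff, funext_iff]
  refine and_congr (and_congr Iff.rfl ?_) (and_congr (forall_congr' fun σ => ?_) Iff.rfl)
  · simp
  · have h1 : (σ.mult : ℝ) / (2 * Real.pi) ≠ 0 :=
      div_ne_zero (by exact_mod_cast InfinitePlace.mult_ne_zero) (by positivity)
    have h2 : 0 < ‖(infComp σ x : σ.Completion)‖ := norm_pos_iff.2 (Units.ne_zero _)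
    change _ * Real.log _ = 0 ↔ _
    rw [mul_eq_zero, or_iff_right h1]
    refine ⟨fun h => Real.eq_one_of_pos_of_log_eq_zero h2 h, fun h => by rw [h, Real.log_one]⟩

lemma eq_one_of_arg_circle {z : ℂ} (h1 : ‖z‖ = 1)
    (h : ((Complex.arg z / (2 * Real.pi) : ℝ) : UnitAddCircle) = 0) : z = 1 := by
  rw [AddCircle.coe_eq_zero_iff] at h
  obtain ⟨n, hn⟩ := h
  have hpi := Real.pi_pos
  have h2 : Complex.arg z = n * (2 * Real.pi) := by
    field_simp at hn
    simp at hn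
    linarith
  rw [← Complex.norm_mul_exp_arg_mul_I z, h1, h2]
  push_cast
  rw [one_mul, mul_assoc, Complex.exp_int_mul_two_pi_mul_I]

/-- The kernel of `ℒ_S` on `U_S` is `U(𝔪)`. -/
lemma logS_eq_one_iff_mem_U {x : Ideles F} (hx : x ∈ D.US) : D.logS x = 1 ↔ x ∈ U m := by
  rw [logS_eq_one_iff]
  constructor
  · rintro ⟨⟨h1, h2⟩, h3, h4⟩
    have hu := D.units_of_mem_US hx h1
    obtain ⟨h5, h6⟩ := (D.residue_eq_one_iff_of_units hu).1 h2
    have h7 : ∀ σ : RealPlace F, |(realComp σ x : ℝ)| = 1 := fun σ => by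
      rw [← norm_infComp_real, h3]
    refine ⟨fun p => ⟨hu p, h5 p⟩, fun σ hσ => Units.ext ?_, fun σ => ?_, fun σ => Units.ext ?_⟩
    · rw [← abs_of_pos (h6 σ hσ), h7]; rfl
    · refine (eq_or_eq_neg_of_abs_eq (h7 σ)).imp (fun h => Units.ext h) fun h => Units.ext ?_
      rw [h]; rfl
    · exact eq_one_of_arg_circle (by rw [← norm_infComp_complex, h3]) (h4 σ)
  · rintro ⟨h1, h2, h3, h4⟩
    refine ⟨⟨fun p => (ord_eq_zero_iff _ _).2 (h1 _).1,
      (D.residue_eq_one_iff_of_units fun p => (h1 p).1).2 ⟨fun p => (h1 p).2, fun σ hσ => ?_⟩⟩,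
      fun σ => ?_, fun σ => ?_⟩
    · rw [h2 σ hσ]; simp
    · rcases σ.isReal_or_isComplex with hσ | hσ
      · rw [norm_infComp_real ⟨σ, hσ⟩]
        rcases h3 ⟨σ, hσ⟩ with h | h <;> simp [h]
      · rw [norm_infComp_complex ⟨σ, hσ⟩, h4]; simp
    · rw [h4]; simp

lemma U_le_US : U m ≤ D.US := fun _ hx p _ => (hx.1 p).1

end LogData

/-! ### Surjectivity of the logarithm -/

/-- Local lifts of a class prime to `𝔪_f` are units at the primes dividing `𝔪_f`, and at the other
primes the lift is arbitrary. -/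
lemma exists_unit_reduction (m : Modulus F) (c : (𝓞 F ⧸ m.fin)ˣ) :
    ∃ u : ∀ p : Primes F, (p.adicCompletionIntegers F)ˣ,
      reduction m (fun p => (u p : p.adicCompletionIntegers F)) = c := by
  classical
  obtain ⟨a, ha⟩ := reduction_surjective m c
  obtain ⟨b, hb⟩ := reduction_surjective m (c⁻¹ : (𝓞 F ⧸ m.fin)ˣ)
  have hab : a * b - 1 ∈ modIdeal m := by
    rw [← reduction_eq_iff, map_mul, ha, hb, map_one, Units.mul_inv]
  have hu : ∀ p : Primes F, m.exponent p ≠ 0 → IsUnit (a p) := by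
    intro p hp
    rw [HeightOneSpectrum.adicCompletionIntegers.isUnit_iff_valued_eq_one]
    have h1 :
        Valued.v (((a p * b p : p.adicCompletionIntegers F) : p.adicCompletion F) - 1) < 1 := by
      refine (hab p).trans_lt ?_
      rw [← WithZero.exp_zero, WithZero.exp_lt_exp]
      omega
    have h2 : Valued.v ((a p * b p : p.adicCompletionIntegers F) : p.adicCompletion F) = 1 := by
      have h3 := Valuation.map_one_add_of_lt (v := Valued.v) h1
      rwa [add_sub_cancel] at h3
    have h3 : Valued.v (a p : p.adicCompletion F) * Valued.v (b p : p.adicCompletion F) = 1 := by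
      rw [← map_mul]; exact h2
    exact eq_one_of_one_le_mul_left (a p).2 (b p).2 h3.ge
  refine ⟨fun p => if hp : m.exponent p ≠ 0 then (hu p hp).unit else 1, ?_⟩
  rw [← ha, reduction_eq_iff]
  intro p
  by_cases hp : m.exponent p = 0
  · simp only [hp, Pi.sub_apply]
    simpa using! ((1 - a p : p.adicCompletionIntegers F)).2
  · simp [hp]

open scoped Classical in
/-- The units `±1` of the completions with given signs at the places of the modulus. -/
def signUnit (m : Modulus F) (s : m.inf → ℤˣ) (σ : InfinitePlace F) : (σ.Completion)ˣ :=
  if h : ∃ hσ : σ.IsReal, (⟨σ, hσ⟩ : RealPlace F) ∈ m.inf then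
    Units.map (Int.castRingHom σ.Completion).toMonoidHom (s ⟨⟨σ, h.1⟩, h.2⟩) else 1

lemma signUnit_eq_one_or (m : Modulus F) (s : m.inf → ℤˣ) (σ : InfinitePlace F) :
    signUnit m s σ = 1 ∨ signUnit m s σ = -1 := by
  unfold signUnit
  split_ifs with h
  · rcases Int.units_eq_one_or (s ⟨⟨σ, h.1⟩, h.2⟩) with h' | h' <;> rw [h']
    · left; simp
    · right; ext; simp
  · exact Or.inl rfl

lemma signUnit_complex (m : Modulus F) (s : m.inf → ℤˣ) (σ : ComplexPlace F) :
    signUnit m s σ.1 = 1 :=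
  dif_neg fun ⟨h, _⟩ => InfinitePlace.not_isReal_iff_isComplex.2 σ.2 h

lemma signUnit_of_mem (m : Modulus F) (s : m.inf → ℤˣ) (σ : m.inf) :
    signUnit m s σ.1.1 =
      Units.map (Int.castRingHom σ.1.1.Completion).toMonoidHom (s σ) :=
  dif_pos ⟨σ.1.2, σ.2⟩

open scoped Classical in
/-- The nonzero element of `F_σ` of absolute value `exp (2π t / n_σ)` which is positive if `σ` is
real, and has argument `2π θ` if `σ` is complex. -/
def expUnit (tθ : (InfinitePlace F → ℝ) × (ComplexPlace F → ℝ)) (σ : InfinitePlace F) :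
    (σ.Completion)ˣ :=
  if h : σ.IsReal then
    Units.map (InfinitePlace.Completion.ringEquivRealOfIsReal h).symm.toMonoidHom
      (Units.mk0 (Real.exp (2 * Real.pi * tθ.1 σ)) (Real.exp_ne_zero _))
  else
    Units.map (InfinitePlace.Completion.ringEquivComplexOfIsComplex
      (InfinitePlace.not_isReal_iff_isComplex.1 h)).symm.toMonoidHom
      (Units.mk0 (Complex.exp ((Real.pi * tθ.1 σ : ℝ) +
        (2 * Real.pi * tθ.2 ⟨σ, InfinitePlace.not_isReal_iff_isComplex.1 h⟩ : ℝ) * Complex.I))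
        (Complex.exp_ne_zero _))

lemma realComp_of_infComp (σ : RealPlace F) {x : Ideles F} {z : (σ.1.Completion)ˣ}
    (h : infComp σ.1 x = z) : (realComp σ x : ℝ) =
      InfinitePlace.Completion.extensionEmbeddingOfIsReal σ.2 z := by rw [← h]; rfl

lemma complexComp_of_infComp (σ : ComplexPlace F) {x : Ideles F} {z : (σ.1.Completion)ˣ}
    (h : infComp σ.1 x = z) : (complexComp σ x : ℂ) =
      InfinitePlace.Completion.extensionEmbedding σ.1 z := by rw [← h]; rfl

lemma extensionEmbeddingOfIsReal_expUnit (tθ : (InfinitePlace F → ℝ) × (ComplexPlace F → ℝ))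
    (σ : RealPlace F) : InfinitePlace.Completion.extensionEmbeddingOfIsReal σ.2
      (expUnit tθ σ.1 : σ.1.Completion) = Real.exp (2 * Real.pi * tθ.1 σ.1) := by
  rw [expUnit, dif_pos σ.2]
  exact (InfinitePlace.Completion.ringEquivRealOfIsReal σ.2).apply_symm_apply _

lemma extensionEmbedding_expUnit (tθ : (InfinitePlace F → ℝ) × (ComplexPlace F → ℝ))
    (σ : ComplexPlace F) : InfinitePlace.Completion.extensionEmbedding σ.1
      (expUnit tθ σ.1 : σ.1.Completion) =
        Complex.exp ((Real.pi * tθ.1 σ.1 : ℝ) + (2 * Real.pi * tθ.2 σ : ℝ) * Complex.I) := by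
  rw [expUnit, dif_neg (InfinitePlace.not_isReal_iff_isComplex.2 σ.2)]
  exact (InfinitePlace.Completion.ringEquivComplexOfIsComplex σ.2).apply_symm_apply _

lemma continuous_coe_expUnit (σ : InfinitePlace F) :
    Continuous fun tθ : (InfinitePlace F → ℝ) × (ComplexPlace F → ℝ) =>
      (expUnit tθ σ : σ.Completion) := by
  by_cases h : σ.IsReal
  · simp only [expUnit, dif_pos h]
    change Continuous fun tθ : (InfinitePlace F → ℝ) × (ComplexPlace F → ℝ) =>
      (InfinitePlace.Completion.isometryEquivRealOfIsReal h).symm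
        (Real.exp (2 * Real.pi * tθ.1 σ))
    exact (IsometryEquiv.continuous _).comp (by fun_prop)
  · simp only [expUnit, dif_neg h]
    have h' := InfinitePlace.not_isReal_iff_isComplex.1 h
    change Continuous fun tθ : (InfinitePlace F → ℝ) × (ComplexPlace F → ℝ) =>
      (InfinitePlace.Completion.isometryEquivComplexOfIsComplex h').symm
        (Complex.exp ((Real.pi * tθ.1 σ : ℝ) + (2 * Real.pi * tθ.2 ⟨σ, h'⟩ : ℝ) * Complex.I))
    exact (IsometryEquiv.continuous _).comp (by fun_prop)

/-- The archimedean exponential `ℝ^n → 𝔸_Fˣ`. -/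
def expIdele (tθ : (InfinitePlace F → ℝ) × (ComplexPlace F → ℝ)) : Ideles F :=
  localIdele (fun σ => expUnit tθ σ, 1)

lemma realComp_expIdele (tθ) (σ : RealPlace F) :
    (realComp σ (expIdele tθ) : ℝ) = Real.exp (2 * Real.pi * tθ.1 σ.1) :=
  extensionEmbeddingOfIsReal_expUnit tθ σ

lemma complexComp_expIdele (tθ) (σ : ComplexPlace F) : (complexComp σ (expIdele tθ) : ℂ) =
    Complex.exp ((Real.pi * tθ.1 σ.1 : ℝ) + (2 * Real.pi * tθ.2 σ : ℝ) * Complex.I) :=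
  extensionEmbedding_expUnit tθ σ

lemma continuous_expIdele : Continuous (expIdele (F := F)) := by
  rw [Units.continuous_iff]
  constructor
  · exact Continuous.prodMk (continuous_pi fun σ => continuous_coe_expUnit σ)
      (continuous_const (y := (1 : FiniteAdeleRing (𝓞 F) F)))
  · refine Continuous.prodMk (continuous_pi fun σ => ?_)
      (continuous_const (y := (1 : FiniteAdeleRing (𝓞 F) F)))
    change Continuous fun tθ => (((expUnit tθ σ)⁻¹ : (σ.Completion)ˣ) : σ.Completion)
    simp only [Units.val_inv_eq_inv_val]
    exact (continuous_coe_expUnit σ).inv₀ fun _ => Units.ne_zero _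

lemma coe_arg_exp (a b : ℝ) :
    ((Complex.arg (Complex.exp (a + (2 * Real.pi * b : ℝ) * Complex.I)) / (2 * Real.pi) : ℝ) :
      UnitAddCircle) = b := by
  have hpi := Real.pi_pos
  rw [← sub_eq_zero, ← AddCircle.coe_sub, AddCircle.coe_eq_zero_iff]
  have h : (Complex.arg (Complex.exp (a + (2 * Real.pi * b : ℝ) * Complex.I)) : Real.Angle) =
      (2 * Real.pi * b : ℝ) := by
    rw [Complex.exp_add, ← Complex.ofReal_exp, Complex.arg_real_mul _ (Real.exp_pos a),
      Complex.arg_exp_mul_I, Real.Angle.coe_toIocMod]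
  rw [Real.Angle.angle_eq_iff_two_pi_dvd_sub] at h
  obtain ⟨k, hk⟩ := h
  refine ⟨k, ?_⟩
  rw [zsmul_one]
  field_simp
  linarith

namespace LogData

variable {m : Modulus F} (D : LogData m)

lemma mem_US_of_units {x : Ideles F}
    (hx : ∀ p, Valued.v (finComp p x : p.adicCompletion F) = 1) : x ∈ D.US := fun p _ => hx p

lemma expIdele_mem_US (tθ) : expIdele tθ ∈ D.US :=
  D.mem_US_of_units fun p => valued_finComp_localIdele _ p

lemma logS_expIdele (tθ) : D.logS (expIdele tθ) = Multiplicative.ofAdd (D.proj (0, tθ)) := by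
  have hpi := Real.pi_pos
  have hu : ∀ p, Valued.v (finComp p (expIdele tθ) : p.adicCompletion F) = 1 :=
    fun p => valued_finComp_localIdele _ p
  rw [logS_apply]
  refine congrArg Multiplicative.ofAdd (Prod.ext (Prod.ext ?_ ?_) (Prod.ext ?_ ?_))
  · funext p
    exact (ord_eq_zero_iff _ _).2 (hu _)
  · rw [(D.residue_eq_one_iff_of_units hu).2, map_one]
    · rfl
    · refine ⟨fun p => ?_, fun σ _ => ?_⟩
      · simp [expIdele]
      · rw [realComp_expIdele]
        exact Real.exp_pos _
  · funext σ
    change _ = tθ.1 σ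
    rcases σ.isReal_or_isComplex with hσ | hσ
    · change (σ.mult : ℝ) / (2 * Real.pi) *
        Real.log ‖(infComp σ (expIdele tθ) : σ.Completion)‖ = tθ.1 σ
      rw [norm_infComp_real ⟨σ, hσ⟩, realComp_expIdele, abs_of_pos (Real.exp_pos _), Real.log_exp,
        InfinitePlace.mult_isReal ⟨σ, hσ⟩]
      push_cast
      field_simp
    · change (σ.mult : ℝ) / (2 * Real.pi) *
        Real.log ‖(infComp σ (expIdele tθ) : σ.Completion)‖ = tθ.1 σ
      rw [norm_infComp_complex ⟨σ, hσ⟩, complexComp_expIdele, Complex.norm_exp,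
        InfinitePlace.mult_isComplex ⟨σ, hσ⟩]
      have : ((Real.pi * tθ.1 σ : ℝ) + (2 * Real.pi * tθ.2 ⟨σ, hσ⟩ : ℝ) * Complex.I : ℂ).re =
        Real.pi * tθ.1 σ := by
        rw [Complex.add_re, Complex.re_ofReal_mul, Complex.I_re, Complex.ofReal_re]; ring
      rw [this, Real.log_exp]
      push_cast
      field_simp
  · funext σ
    change ((Complex.arg (complexComp σ (expIdele tθ) : ℂ) / (2 * Real.pi) : ℝ) : UnitAddCircle) =
      ((tθ.2 σ : ℝ) : UnitAddCircle)
    rw [complexComp_expIdele, coe_arg_exp]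

lemma exists_represents (a : UnitsMod m) : ∃ u, D.Represents u a := by
  obtain ⟨u, hu⟩ := exists_unit_reduction m a.1
  have h1 : ∀ p, Valued.v (finComp p (localIdele (signUnit m a.2, u)) : p.adicCompletion F) = 1 :=
    fun p => valued_finComp_localIdele _ p
  refine ⟨localIdele (signUnit m a.2, u), h1, fun σ => ?_, fun σ => ?_, Prod.ext ?_ ?_⟩
  · refine (signUnit_eq_one_or m a.2 σ.1).imp (fun h => Units.ext ?_) fun h => Units.ext ?_
    · rw [realComp_of_infComp σ (infComp_localIdele _ _)]; simp [h]
    · rw [realComp_of_infComp σ (infComp_localIdele _ _)]; simp [h]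
  · refine Units.ext ?_
    rw [complexComp_of_infComp σ (infComp_localIdele _ _)]; simp [signUnit_complex]
  · refine Units.ext (Eq.trans ?_ hu)
    change reduction m _ = _
    congr 1
    funext p
    refine Subtype.ext ?_
    exact D.coe_unitPart_of_ord_eq_zero p _ ((ord_eq_zero_iff _ _).2 (h1 p))
  · funext σ
    refine Units.ext ?_
    change ((SignType.sign (realComp σ.1 (localIdele (signUnit m a.2, u)) : ℝ) : SignType) : ℤ) = _
    rw [realComp_of_infComp σ.1 (infComp_localIdele _ _)]
    simp only [signUnit_of_mem]
    rcases Int.units_eq_one_or (a.2 σ) with h | h <;> simp [h]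

variable {D} in
lemma Represents.mem_US {u : Ideles F} {a : UnitsMod m} (h : D.Represents u a) : u ∈ D.US :=
  D.mem_US_of_units h.1

variable {D} in
lemma Represents.logS {u : Ideles F} {a : UnitsMod m} (h : D.Represents u a) :
    D.logS u = Multiplicative.ofAdd (((0, (D.logMod a).toAdd), 0) : D.MQuot) := by
  rw [logS_apply]
  refine congrArg Multiplicative.ofAdd (Prod.ext (Prod.ext ?_ ?_) (Prod.ext ?_ ?_))
  · funext p
    exact (ord_eq_zero_iff _ _).2 (h.1 _)
  · rw [h.2.2.2]
  · funext σ
    have : ‖(infComp σ u : σ.Completion)‖ = 1 := by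
      rcases σ.isReal_or_isComplex with hσ | hσ
      · rw [norm_infComp_real ⟨σ, hσ⟩]
        rcases h.2.1 ⟨σ, hσ⟩ with h | h <;> simp [h]
      · rw [norm_infComp_complex ⟨σ, hσ⟩, h.2.2.1]; simp
    simp [this]
  · funext σ
    simp [h.2.2.1 σ]

lemma finEmb_mem_US (p : D.S) (z) : finEmb p.1 z ∈ D.US := fun q hq => by
  rw [finComp_finEmb_of_ne (fun h : q = p.1 => hq (h.symm ▸ p.2))]; simp

lemma logS_finEmb_unif [DecidableEq D.S] (p : D.S) :
    D.logS (finEmb p.1 (D.unif p.1)) = Multiplicative.ofAdd (D.proj ((Pi.single p 1, 0), 0)) := by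
  rw [logS_apply]
  refine congrArg Multiplicative.ofAdd (Prod.ext (Prod.ext ?_ ?_) (Prod.ext ?_ ?_))
  · funext q
    change ord q.1 (finComp q.1 (finEmb p.1 (D.unif p.1))) = (Pi.single p 1 : D.S → ℤ) q
    by_cases h : q = p
    · subst h
      rw [finComp_finEmb_self, D.ord_unif, Pi.single_eq_same]
    · rw [finComp_finEmb_of_ne (fun h' => h (Subtype.ext h')), ord_one, Pi.single_eq_of_ne h]
  · have : D.residue (finEmb p.1 (D.unif p.1)) = 1 := by
      refine Prod.ext ((D.residue_fst_eq_one_iff _).2 fun q => ?_) ?_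
      · have h1 : D.unitPart q (finComp q (finEmb p.1 (D.unif p.1))) = 1 := by
          by_cases h : q = p.1
          · subst h
            rw [finComp_finEmb_self]
            refine Units.ext (Subtype.ext ?_)
            change ((D.unif p.1 * D.unif p.1 ^ (-ord p.1 (D.unif p.1)) :
              (p.1.adicCompletion F)ˣ) : p.1.adicCompletion F) = 1
            rw [D.ord_unif]
            simp
          · rw [finComp_finEmb_of_ne h, map_one]
        rw [h1]
        simp
      · funext σ
        refine (signs_apply_eq_one_iff m _ σ).2 ?_
        rw [realComp_of_infComp σ.1 (infComp_finEmb _ _ _)]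
        simp
    rw [this, map_one]; rfl
  · funext σ
    simp [infComp_finEmb, proj]
  · funext σ
    have : complexComp σ (finEmb p.1 (D.unif p.1)) = 1 := by
      refine Units.ext ?_
      rw [complexComp_of_infComp σ (infComp_finEmb _ _ _)]
      simp
    simp [proj, this]

/-- `ℒ_S` maps `U_S` onto `(ℤ^ℓ × ℝ^n)/(Λ_𝔪 + ℤ^{r₂})`. -/
lemma exists_logS_eq (y : D.M) :
    ∃ x ∈ D.US, D.logS x = Multiplicative.ofAdd (D.proj y) := by
  classical
  let T : AddSubgroup D.M := (Subgroup.toAddSubgroup' (D.US.map D.logS)).comap D.proj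
  have hT : ∀ y, y ∈ T ↔ ∃ x ∈ D.US, D.logS x = Multiplicative.ofAdd (D.proj y) := fun y => Iff.rfl
  rw [← hT]
  have h1 : y = (∑ p : D.S, y.1.1 p • (((Pi.single p 1, 0), 0) : D.M)) +
      ((0, y.1.2), 0) + (0, y.2) := by
    refine Prod.ext (Prod.ext ?_ ?_) ?_
    · funext q
      simp [Prod.fst_sum, Finset.sum_apply, Pi.single_apply]
    · simp [Prod.fst_sum, Prod.snd_sum]
    · simp [Prod.snd_sum]
  rw [h1]
  refine add_mem (add_mem (sum_mem fun p _ => zsmul_mem ?_ _) ?_) ?_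
  · exact (hT _).2 ⟨_, D.finEmb_mem_US p _, D.logS_finEmb_unif p⟩
  · obtain ⟨u, hu⟩ := D.exists_represents (D.logMod.symm (Multiplicative.ofAdd
      (QuotientAddGroup.mk y.1.2)))
    refine (hT _).2 ⟨u, hu.mem_US, ?_⟩
    rw [hu.logS, MulEquiv.apply_symm_apply]
    refine congrArg Multiplicative.ofAdd (Prod.ext rfl (Prod.ext rfl ?_))
    funext σ
    simp [proj]
  · exact (hT _).2 ⟨_, D.expIdele_mem_US _, D.logS_expIdele _⟩

end LogData

/-! ### Primes generating the class group -/

/-- The exponent of the prime `q` in the factorization of a nonzero ideal, written with the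
expression which defines `HeightOneSpectrum.intValuation`. -/
def idealOrd (q : Primes F) (I : Ideal (𝓞 F)) : ℕ :=
  (Associates.mk q.asIdeal).count (Associates.mk I).factors

lemma idealOrd_mul (q : Primes F) {I J : Ideal (𝓞 F)} (hI : I ≠ 0) (hJ : J ≠ 0) :
    idealOrd q (I * J) = idealOrd q I + idealOrd q J := by
  rw [idealOrd, ← Associates.mk_mul_mk, Associates.count_mul (Associates.mk_ne_zero.2 hI)
    (Associates.mk_ne_zero.2 hJ) q.associates_irreducible]
  rfl

lemma idealOrd_pow (q : Primes F) {I : Ideal (𝓞 F)} (hI : I ≠ 0) (n : ℕ) :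
    idealOrd q (I ^ n) = n * idealOrd q I := by
  rw [idealOrd, Associates.mk_pow, Associates.count_pow (Associates.mk_ne_zero.2 hI)
    q.associates_irreducible]
  rfl

lemma idealOrd_self (q : Primes F) : idealOrd q q.asIdeal = 1 :=
  Associates.count_self q.associates_irreducible

lemma idealOrd_of_ne {p q : Primes F} (h : q ≠ p) : idealOrd q p.asIdeal = 0 := by
  refine Associates.count_eq_zero_of_ne q.associates_irreducible p.associates_irreducible ?_
  intro h'
  rw [Associates.mk_eq_mk_iff_associated, associated_iff_eq] at h'
  exact h (HeightOneSpectrum.ext h')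

lemma valuation_of_ne_zero (q : Primes F) {a : 𝓞 F} (ha : a ≠ 0) :
    q.valuation F (algebraMap (𝓞 F) F a) = WithZero.exp (-(idealOrd q (Ideal.span {a}) : ℤ)) := by
  rw [HeightOneSpectrum.valuation_of_algebraMap, HeightOneSpectrum.intValuation_if_neg _ ha]
  rfl

/-- The class of a prime ideal. -/
def primeClass (p : Primes F) : ClassGroup (𝓞 F) :=
  ClassGroup.mk0 ⟨p.asIdeal, mem_nonZeroDivisors_of_ne_zero p.ne_bot⟩

/-- Since the class group is finite, inverses are not needed to write a class in terms of the primes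
of `S`, so that it contains an integral ideal supported on `S`. -/
lemma exists_ideal_of_mem_closure (S : Finset (Primes F)) {c : ClassGroup (𝓞 F)}
    (hc : c ∈ Subgroup.closure (primeClass '' (S : Set (Primes F)))) :
    ∃ I : nonZeroDivisors (Ideal (𝓞 F)), (∀ q ∉ S, idealOrd q (I : Ideal (𝓞 F)) = 0) ∧
      ClassGroup.mk0 I = c := by
  have hpow : ∀ (I : nonZeroDivisors (Ideal (𝓞 F))) (n : ℕ),
      (∀ q ∉ S, idealOrd q (I : Ideal (𝓞 F)) = 0) →
      ∀ q ∉ S, idealOrd q ((I ^ n : nonZeroDivisors (Ideal (𝓞 F))) : Ideal (𝓞 F)) = 0 := by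
    intro I n hI q hq
    rw [SubmonoidClass.coe_pow, idealOrd_pow q (nonZeroDivisors.coe_ne_zero I), hI q hq, mul_zero]
  induction hc using Subgroup.closure_induction with
  | mem c hc =>
    obtain ⟨p, hp, rfl⟩ := hc
    exact ⟨_, fun q hq => idealOrd_of_ne (fun h : q = p => hq (h.symm ▸ hp)), rfl⟩
  | one =>
    refine ⟨1, fun q hq => ?_, map_one _⟩
    have h1 := idealOrd_mul q (I := 1) (J := 1) one_ne_zero one_ne_zero
    rw [mul_one] at h1
    change idealOrd q 1 = 0
    omega
  | mul a b _ _ ha hb =>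
    obtain ⟨I, hI, rfl⟩ := ha
    obtain ⟨J, hJ, rfl⟩ := hb
    refine ⟨I * J, fun q hq => ?_, map_mul _ _ _⟩
    rw [Submonoid.coe_mul, idealOrd_mul q (nonZeroDivisors.coe_ne_zero I)
      (nonZeroDivisors.coe_ne_zero J), hI q hq, hJ q hq]
  | inv a _ ha =>
    obtain ⟨I, hI, rfl⟩ := ha
    refine ⟨I ^ (Nat.card (ClassGroup (𝓞 F)) - 1), hpow _ _ hI, ?_⟩
    rw [map_pow, eq_inv_iff_mul_eq_one, ← pow_succ, Nat.sub_add_cancel Nat.card_pos,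
      pow_card_eq_one']

open scoped Classical in
/-- A power of every prime ideal is principal. -/
lemma exists_principal_power (p : Primes F) : ∃ n : ℕ, 0 < n ∧ ∃ α : Fˣ, ∀ q : Primes F,
    q.valuation F (α : F) = WithZero.exp (-(if q = p then n else 0 : ℤ)) := by
  refine ⟨Nat.card (ClassGroup (𝓞 F)), Nat.card_pos, ?_⟩
  set n := Nat.card (ClassGroup (𝓞 F))
  have h1 : p.asIdeal ^ n ∈ nonZeroDivisors (Ideal (𝓞 F)) :=
    mem_nonZeroDivisors_of_ne_zero (pow_ne_zero _ p.ne_bot)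
  have h2 : (p.asIdeal ^ n).IsPrincipal := by
    rw [← ClassGroup.mk0_eq_one_iff h1]
    have : (⟨p.asIdeal ^ n, h1⟩ : nonZeroDivisors (Ideal (𝓞 F))) =
      ⟨p.asIdeal, mem_nonZeroDivisors_of_ne_zero p.ne_bot⟩ ^ n := Subtype.ext rfl
    rw [this, map_pow, pow_card_eq_one']
  obtain ⟨a, ha⟩ := h2
  rw [Ideal.submodule_span_eq] at ha
  have ha0 : a ≠ 0 := by
    rintro rfl
    refine pow_ne_zero n p.ne_bot (ha.trans ?_)
    simp
  have ha' : algebraMap (𝓞 F) F a ≠ 0 := by simpa using ha0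
  refine ⟨Units.mk0 _ ha', fun q => ?_⟩
  rw [Units.val_mk0, valuation_of_ne_zero q ha0, ← ha, idealOrd_pow q p.ne_bot]
  congr 2
  split_ifs with hqp
  · subst hqp
    rw [idealOrd_self, mul_one]
  · rw [idealOrd_of_ne hqp, mul_zero]; rfl

lemma valued_eq_exp_ord (p : Primes F) (x : (p.adicCompletion F)ˣ) :
    Valued.v (x : p.adicCompletion F) = WithZero.exp (-ord p x) := by
  have hx : Valued.v (x : p.adicCompletion F) ≠ 0 := (Valuation.ne_zero_iff _).2 x.ne_zero
  rw [ord, neg_neg, WithZero.exp_log hx]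

lemma finite_ord_ne_zero (x : Ideles F) :
    {p : Primes F | ord p (finComp p x) ≠ 0}.Finite := by
  have h1 : ∀ᶠ p : Primes F in Filter.cofinite,
    (finComp p x : p.adicCompletion F) ∈ p.adicCompletionIntegers F := x.val.2.2
  have h2 : ∀ᶠ p : Primes F in Filter.cofinite,
    (((finComp p x)⁻¹ : (p.adicCompletion F)ˣ) : p.adicCompletion F) ∈
      p.adicCompletionIntegers F := x.inv.2.2
  have h3 : ∀ᶠ p : Primes F in Filter.cofinite, ord p (finComp p x) = 0 := by
    filter_upwards [h1, h2] with p hp hp'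
    rw [HeightOneSpectrum.mem_adicCompletionIntegers, valued_eq_exp_ord, ← WithZero.exp_zero,
      WithZero.exp_le_exp] at hp hp'
    rw [ord_inv] at hp'
    omega
  exact h3

namespace LogData

variable {m : Modulus F} (D : LogData m)

open scoped Classical in
/-- Outside `S`, every prime ideal is principal. -/
lemma exists_global_uniformizer (p : Primes F) : ∃ α : Fˣ, ∀ q ∉ D.S,
    q.valuation F (α : F) = WithZero.exp (-(if q = p then 1 else 0 : ℤ)) := by
  obtain ⟨I, hI, hIp⟩ := exists_ideal_of_mem_closure (F := F) D.S (c := primeClass p)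
    (by rw [show Subgroup.closure (primeClass '' (D.S : Set (Primes F))) = ⊤ from D.S_generates]
        exact Subgroup.mem_top _)
  obtain ⟨x, y, hx, hy, hxy⟩ := ClassGroup.mk0_eq_mk0_iff.1 hIp
  have hx' : algebraMap (𝓞 F) F x ≠ 0 := by simpa using hx
  have hy' : algebraMap (𝓞 F) F y ≠ 0 := by simpa using hy
  refine ⟨Units.mk0 _ (div_ne_zero hx' hy'), fun q hq => ?_⟩
  have h := congrArg (idealOrd q) hxy
  rw [idealOrd_mul q (by simpa using hx) (nonZeroDivisors.coe_ne_zero I),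
    idealOrd_mul q (by simpa using hy) p.ne_bot, hI q hq] at h
  rw [Units.val_mk0, map_div₀, valuation_of_ne_zero q hx, valuation_of_ne_zero q hy,
    ← WithZero.exp_sub]
  congr 1
  split_ifs with hqp
  · subst hqp
    rw [idealOrd_self] at h
    omega
  · rw [idealOrd_of_ne hqp] at h
    omega

/-- Every idèle is the product of an `S`-idèle and a principal idèle. -/
lemma exists_mul_principal_inv_mem_US (x : Ideles F) : ∃ α : Fˣ, x * (principal α)⁻¹ ∈ D.US := by
  classical
  choose α hα using D.exists_global_uniformizer
  have hfin := finite_ord_ne_zero x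
  refine ⟨∏ p ∈ hfin.toFinset, α p ^ ord p (finComp p x), fun q hq => ?_⟩
  have h1 : q.valuation F ((∏ p ∈ hfin.toFinset, α p ^ ord p (finComp p x) : Fˣ) : F) =
      WithZero.exp (-ord q (finComp q x)) := by
    rw [Units.coe_prod, map_prod]
    have h2 : ∀ p ∈ hfin.toFinset, q.valuation F ((α p ^ ord p (finComp p x) : Fˣ) : F) =
        if p = q then WithZero.exp (-ord q (finComp q x)) else 1 := by
      intro p _
      rw [Units.val_zpow_eq_zpow_val, map_zpow₀, hα p q hq]
      split_ifs with h h' h'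
      · subst h; rw [← WithZero.exp_zsmul]; simp
      · exact absurd h.symm h'
      · exact absurd h'.symm h
      · simp
    rw [Finset.prod_congr rfl h2, Finset.prod_ite_eq']
    split_ifs with h
    · rfl
    · have : ord q (finComp q x) = 0 := by simpa using h
      rw [this]; simp
  rw [map_mul, map_inv, Units.val_mul, Units.val_inv_eq_inv_val, map_mul, map_inv₀,
    valued_finComp_principal, h1, valued_eq_exp_ord]
  exact mul_inv_cancel₀ WithZero.exp_ne_zero

end LogData

/-! ### Idèles close to `1` -/

lemma continuous_coe_snd : Continuous fun x : Ideles F => (x.val.2 : FiniteAdeleRing (𝓞 F) F) :=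
  continuous_snd.comp Units.continuous_val

lemma continuous_inv_snd : Continuous fun x : Ideles F => (x.inv.2 : FiniteAdeleRing (𝓞 F) F) :=
  continuous_snd.comp Units.continuous_coe_inv

lemma continuous_finComp (p : Primes F) :
    Continuous fun x : Ideles F => (finComp p x : p.adicCompletion F) :=
  (RestrictedProduct.continuous_eval p).comp (continuous_snd.comp Units.continuous_val)

lemma continuous_infComp (σ : InfinitePlace F) :
    Continuous fun x : Ideles F => (infComp σ x : σ.Completion) :=
  (continuous_apply (A := fun τ : InfinitePlace F => τ.Completion) σ).comp
    (continuous_fst.comp Units.continuous_val)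

lemma continuous_realComp (σ : RealPlace F) :
    Continuous fun x : Ideles F => (realComp σ x : ℝ) :=
  (InfinitePlace.Completion.isometry_extensionEmbeddingOfIsReal σ.2).continuous.comp
    (continuous_infComp σ.1)

lemma continuous_complexComp (σ : ComplexPlace F) :
    Continuous fun x : Ideles F => (complexComp σ x : ℂ) :=
  (InfinitePlace.Completion.isometry_extensionEmbedding σ.1).continuous.comp
    (continuous_infComp σ.1)

lemma eventually_valued_eq_one : ∀ᶠ x : Ideles F in 𝓝 1,
    ∀ p, Valued.v (finComp p x : p.adicCompletion F) = 1 := by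
  have hopen : IsOpen {a : FiniteAdeleRing (𝓞 F) F | ∀ p, a p ∈ p.adicCompletionIntegers F} :=
    RestrictedProduct.isOpen_forall_mem fun _ => Valued.isOpen_valuationSubring _
  have h1 : ∀ᶠ x : Ideles F in 𝓝 1, ∀ p, x.val.2 p ∈ p.adicCompletionIntegers F :=
    (hopen.preimage continuous_coe_snd).mem_nhds fun p => one_mem (p.adicCompletionIntegers F)
  have h2 : ∀ᶠ x : Ideles F in 𝓝 1, ∀ p, x.inv.2 p ∈ p.adicCompletionIntegers F :=
    (hopen.preimage continuous_inv_snd).mem_nhds fun p => one_mem (p.adicCompletionIntegers F)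
  filter_upwards [h1, h2] with x hx hx' p
  have h3 : Valued.v (finComp p x : p.adicCompletion F) ≤ 1 := hx p
  have h4 : Valued.v (((finComp p x)⁻¹ : (p.adicCompletion F)ˣ) : p.adicCompletion F) ≤ 1 := hx' p
  rw [valued_eq_exp_ord, ← WithZero.exp_zero, WithZero.exp_le_exp] at h3 h4
  rw [ord_inv] at h4
  rw [← ord_eq_zero_iff]
  omega

lemma eventually_valued_sub_one (m : Modulus F) : ∀ᶠ x : Ideles F in 𝓝 1, ∀ p,
    Valued.v ((finComp p x : p.adicCompletion F) - 1) ≤ WithZero.exp (-(m.exponent p : ℤ)) := by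
  have hfin : {p : Primes F | p.asIdeal ∣ m.fin}.Finite := Ideal.finite_factors m.fin_ne_bot
  have h1 : ∀ᶠ x : Ideles F in 𝓝 1, ∀ p ∈ {p : Primes F | p.asIdeal ∣ m.fin},
      Valued.v ((finComp p x : p.adicCompletion F) - 1) < WithZero.exp (-(m.exponent p : ℤ)) := by
    rw [Filter.eventually_all_finite hfin]
    intro p _
    refine ((isOpen_valued_lt p (m.exponent p)).preimage
      ((continuous_finComp p).sub continuous_const)).mem_nhds ?_
    simp
  filter_upwards [h1, eventually_valued_eq_one] with x hx hx' p
  by_cases hp : p.asIdeal ∣ m.fin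
  · exact (hx p hp).le
  · rw [Modulus.exponent, multiplicity_eq_zero.2 hp]
    refine (Valuation.map_sub _ _ _).trans ?_
    rw [hx' p]
    simp

/-- The archimedean part of the logarithm, with the arguments lifted from `ℝ/ℤ` to `(-1/2, 1/2]`. -/
def archLog (x : Ideles F) : (InfinitePlace F → ℝ) × (ComplexPlace F → ℝ) :=
  (fun σ => (σ.mult : ℝ) / (2 * Real.pi) * Real.log ‖(infComp σ x : σ.Completion)‖,
    fun σ => Complex.arg (complexComp σ x : ℂ) / (2 * Real.pi))

lemma continuousAt_archLog : ContinuousAt (archLog (F := F)) 1 := by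
  refine ContinuousAt.prodMk (continuousAt_pi.2 fun σ => ?_) (continuousAt_pi.2 fun σ => ?_)
  · refine continuousAt_const.mul (ContinuousAt.log (continuous_infComp σ).norm.continuousAt ?_)
    simp
  · refine ContinuousAt.div_const (ContinuousAt.comp (g := Complex.arg) ?_
      (continuous_complexComp σ).continuousAt) _
    refine Complex.continuousAt_arg ?_
    simp

/-! ### The isomorphism `ℒ` -/

section QuotientEquiv

variable {G A : Type*} [Group G] [AddCommGroup A] (N : AddSubgroup A) (f : Multiplicative A →* G)

/-- The homomorphism on `A ⧸ N` induced by a homomorphism from `A`, written additively, to `G`,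
written multiplicatively. -/
def quotientLift (hN : ∀ y ∈ N, f (Multiplicative.ofAdd y) = 1) : Multiplicative (A ⧸ N) →* G :=
  AddMonoidHom.toMultiplicativeLeft
    (QuotientAddGroup.lift N (AddMonoidHom.toMultiplicativeLeft.symm f) hN)

/-- The first isomorphism theorem for a homomorphism from an additive to a multiplicative group. -/
def quotientMulEquiv (hf : Function.Surjective f)
    (hN : ∀ y, f (Multiplicative.ofAdd y) = 1 ↔ y ∈ N) : G ≃* Multiplicative (A ⧸ N) :=
  (MulEquiv.ofBijective (quotientLift N f fun y hy => (hN y).2 hy) (by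
    refine ⟨(injective_iff_map_eq_one _).2 fun q hq => ?_, fun c => ?_⟩
    · obtain ⟨y, hy⟩ := QuotientAddGroup.mk_surjective q.toAdd
      obtain rfl : q = Multiplicative.ofAdd (QuotientAddGroup.mk y) := by rw [hy]; rfl
      rw [← ofAdd_zero, Multiplicative.ofAdd.apply_eq_iff_eq]
      exact (QuotientAddGroup.eq_zero_iff _).2 ((hN y).1 hq)
    · obtain ⟨y, hy⟩ := hf c
      exact ⟨Multiplicative.ofAdd (QuotientAddGroup.mk y.toAdd), hy⟩)).symm

lemma quotientMulEquiv_eq_iff (hf : Function.Surjective f)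
    (hN : ∀ y, f (Multiplicative.ofAdd y) = 1 ↔ y ∈ N) (c : G) (y : A) :
    quotientMulEquiv N f hf hN c = Multiplicative.ofAdd (QuotientAddGroup.mk y) ↔
      f (Multiplicative.ofAdd y) = c := by
  rw [quotientMulEquiv, MulEquiv.symm_apply_eq, eq_comm]
  rfl

lemma continuous_quotientMulEquiv_symm [TopologicalSpace G] [TopologicalSpace A]
    (hf : Function.Surjective f) (hN : ∀ y, f (Multiplicative.ofAdd y) = 1 ↔ y ∈ N)
    (hc : Continuous f) : Continuous (quotientMulEquiv N f hf hN).symm := by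
  have h : Continuous fun q : A ⧸ N => quotientLift N f (fun y hy => (hN y).2 hy)
      (Multiplicative.ofAdd q) :=
    (QuotientAddGroup.isQuotientMap_mk N).continuous_iff.2 (hc.comp continuous_ofAdd)
  exact h.comp continuous_toAdd

lemma continuous_quotientMulEquiv_of_isOpenMap [TopologicalSpace G] [TopologicalSpace A]
    (hf : Function.Surjective f) (hN : ∀ y, f (Multiplicative.ofAdd y) = 1 ↔ y ∈ N)
    (hc : Continuous f) (ho : IsOpenMap f) : Continuous (quotientMulEquiv N f hf hN) := by
  refine (ho.isQuotientMap hc hf).continuous_iff.2 ?_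
  have h : (quotientMulEquiv N f hf hN) ∘ f =
      fun y => Multiplicative.ofAdd (QuotientAddGroup.mk y.toAdd) :=
    funext fun y => (quotientMulEquiv_eq_iff N f hf hN _ y.toAdd).2 rfl
  rw [h]
  exact continuous_ofAdd.comp (QuotientAddGroup.continuous_mk.comp continuous_toAdd)

end QuotientEquiv

lemma mk_mul_principal_inv (m : Modulus F) (x : Ideles F) (α : Fˣ) :
    C.mk m (x * (principal α)⁻¹) = C.mk m x := by
  rw [eq_comm, QuotientGroup.eq]
  refine Subgroup.mem_sup_left ⟨α⁻¹, ?_⟩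
  rw [map_inv]
  group

namespace LogData

variable {m : Modulus F} (D : LogData m)

lemma mem_Lam {y : D.M} : y ∈ D.Lam ↔
    ∃ α : Fˣ, principal α ∈ D.US ∧ D.logS (principal α) = Multiplicative.ofAdd (D.proj y) :=
  Iff.rfl

lemma mk_eq_mk_of_logS_eq {x x' : Ideles F} (hx : x ∈ D.US) (hx' : x' ∈ D.US)
    (h : D.logS x = D.logS x') : C.mk m x = C.mk m x' := by
  rw [QuotientGroup.eq]
  refine Subgroup.mem_sup_right ((D.logS_eq_one_iff_mem_U (mul_mem (inv_mem hx) hx')).1 ?_)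
  rw [map_mul, map_inv, h, inv_mul_cancel]

/-- The homomorphism `ℤ^ℓ × ℝ^n → C_𝔪` which sends `y` to the class of any `x ∈ U_S` with
`ℒ_S(x) = y`. -/
def expC : Multiplicative D.M →* C m where
  toFun y := C.mk m (D.exists_logS_eq y.toAdd).choose
  map_one' := by
    have h := (D.exists_logS_eq 0).choose_spec
    refine D.mk_eq_mk_of_logS_eq (x' := 1) h.1 (one_mem _) (h.2.trans ?_)
    rw [map_zero, map_one, ofAdd_zero]
  map_mul' y y' := by
    have h := (D.exists_logS_eq (y.toAdd + y'.toAdd)).choose_spec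
    have h1 := (D.exists_logS_eq y.toAdd).choose_spec
    have h2 := (D.exists_logS_eq y'.toAdd).choose_spec
    refine D.mk_eq_mk_of_logS_eq (x' := _ * _) h.1 (mul_mem h1.1 h2.1) (h.2.trans ?_)
    rw [map_mul, h1.2, h2.2, map_add, ofAdd_add]

lemma expC_eq {y : D.M} {x : Ideles F} (hx : x ∈ D.US)
    (h : D.logS x = Multiplicative.ofAdd (D.proj y)) :
    D.expC (Multiplicative.ofAdd y) = C.mk m x :=
  D.mk_eq_mk_of_logS_eq (D.exists_logS_eq y).choose_spec.1 hx
    ((D.exists_logS_eq y).choose_spec.2.trans h.symm)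

lemma proj_surjective : Function.Surjective D.proj := by
  intro q
  obtain ⟨b, hb⟩ := QuotientAddGroup.mk_surjective q.1.2
  choose θ hθ using fun σ => QuotientAddGroup.mk_surjective (q.2.2 σ)
  exact ⟨((q.1.1, b), (q.2.1, θ)), Prod.ext (Prod.ext rfl hb) (Prod.ext rfl (funext hθ))⟩

lemma expC_surjective : Function.Surjective D.expC := by
  intro c
  obtain ⟨x, hx⟩ := QuotientGroup.mk_surjective c
  obtain ⟨α, hα⟩ := D.exists_mul_principal_inv_mem_US x
  obtain ⟨y, hy⟩ := D.proj_surjective (D.logS (x * (principal α)⁻¹)).toAdd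
  refine ⟨Multiplicative.ofAdd y, (D.expC_eq hα (by rw [hy]; rfl)).trans ?_⟩
  rw [mk_mul_principal_inv, C.mk, hx]

lemma expC_eq_one_iff (y : D.M) : D.expC (Multiplicative.ofAdd y) = 1 ↔ y ∈ D.Lam := by
  rw [mem_Lam]
  obtain ⟨x, hx, hxy⟩ := D.exists_logS_eq y
  rw [D.expC_eq hx hxy, C.mk, QuotientGroup.eq_one_iff, Subgroup.mem_sup]
  constructor
  · rintro ⟨_, ⟨α, rfl⟩, u, hu, rfl⟩
    have hα : principal α ∈ D.US := by
      have := mul_mem hx (inv_mem (D.U_le_US hu))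
      rwa [mul_inv_cancel_right] at this
    refine ⟨α, hα, ?_⟩
    rw [← hxy, map_mul, (D.logS_eq_one_iff_mem_U (D.U_le_US hu)).2 hu, mul_one]
  · rintro ⟨α, hα, h⟩
    refine ⟨principal α, ⟨α, rfl⟩, (principal α)⁻¹ * x, ?_, mul_inv_cancel_left _ _⟩
    rw [← D.logS_eq_one_iff_mem_U (mul_mem (inv_mem hα) hx), map_mul, map_inv, h, hxy,
      inv_mul_cancel]

/-- The logarithm `ℒ` as an isomorphism of groups. -/
def logMulEquiv : C m ≃* Multiplicative (D.M ⧸ D.Lam) :=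
  quotientMulEquiv D.Lam D.expC D.expC_surjective D.expC_eq_one_iff

lemma logMulEquiv_eq_iff (c : C m) (y : D.M) :
    D.logMulEquiv c = Multiplicative.ofAdd (QuotientAddGroup.mk y) ↔
      D.expC (Multiplicative.ofAdd y) = c :=
  quotientMulEquiv_eq_iff D.Lam D.expC D.expC_surjective D.expC_eq_one_iff c y

lemma continuous_expC : Continuous D.expC := by
  refine continuous_of_continuousAt_one D.expC ?_
  have h1 : Continuous fun y : Multiplicative D.M => C.mk m (expIdele y.toAdd.2) :=
    QuotientGroup.continuous_mk.comp
      (continuous_expIdele.comp (continuous_snd.comp continuous_toAdd))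
  refine h1.continuousAt.congr ?_
  -- `ℤ^ℓ` is discrete, so `expC` is the archimedean exponential near the identity
  have h2 : ∀ᶠ y : D.M in 𝓝 0, y.1 = 0 :=
    (continuous_fst.continuousAt (x := (0 : D.M))).eventually
      (isOpen_discrete ({0} : Set ((D.S → ℤ) × (Fin D.r → ℤ))) |>.mem_nhds rfl)
  filter_upwards [h2] with y hy
  have h3 := D.expC_eq (D.expIdele_mem_US y.2) (D.logS_expIdele y.2)
  rw [← hy] at h3
  exact h3.symm

lemma expC_archLog {x : Ideles F} (h1 : ∀ p, Valued.v (finComp p x : p.adicCompletion F) = 1)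
    (h2 : D.residue x = 1) : D.expC (Multiplicative.ofAdd (0, archLog x)) = C.mk m x := by
  refine D.expC_eq (D.mem_US_of_units h1) ?_
  rw [logS_apply]
  refine congrArg Multiplicative.ofAdd (Prod.ext (Prod.ext ?_ ?_) rfl)
  · funext p
    exact (ord_eq_zero_iff _ _).2 (h1 _)
  · rw [h2, map_one]; rfl

lemma continuous_logMulEquiv : Continuous D.logMulEquiv := by
  refine (QuotientGroup.isQuotientMap_mk _).continuous_iff.2 ?_
  let f : Ideles F →* Multiplicative (D.M ⧸ D.Lam) :=
    D.logMulEquiv.toMonoidHom.comp (QuotientGroup.mk' _)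
  suffices h : Continuous f from h
  refine continuous_of_continuousAt_one f ?_
  -- on idèles close to `1`, the logarithm is given by the archimedean components alone
  have h1 : ContinuousAt (fun x : Ideles F => Multiplicative.ofAdd
      (QuotientAddGroup.mk ((0, archLog x) : D.M) : D.M ⧸ D.Lam)) 1 :=
    (continuous_ofAdd.comp QuotientAddGroup.continuous_mk).continuousAt.comp
      (continuousAt_const.prodMk continuousAt_archLog)
  refine h1.congr ?_
  have h2 : ∀ᶠ x : Ideles F in 𝓝 1, ∀ σ : RealPlace F, 0 < (realComp σ x : ℝ) := by
    rw [Filter.eventually_all]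
    intro σ
    refine (continuous_realComp σ).continuousAt.eventually_const_lt ?_
    simp
  filter_upwards [h2, eventually_valued_eq_one, eventually_valued_sub_one m] with x hx hx1 hx2
  refine ((D.logMulEquiv_eq_iff _ _).2 (D.expC_archLog hx1 ?_)).symm
  exact (D.residue_eq_one_iff_of_units hx1).2 ⟨hx2, fun σ _ => hx σ⟩

/-- The logarithm `ℒ` as an isomorphism of topological groups. -/
def logEquiv : C m ≃ₜ* Multiplicative (D.M ⧸ D.Lam) where
  __ := D.logMulEquiv
  continuous_toFun := D.continuous_logMulEquiv
  continuous_invFun := continuous_quotientMulEquiv_symm D.Lam D.expC D.expC_surjective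
    D.expC_eq_one_iff D.continuous_expC

lemma logEquiv_eq_iff (c : C m) (y : D.M) :
    D.logEquiv c = Multiplicative.ofAdd (QuotientAddGroup.mk y) ↔
      D.expC (Multiplicative.ofAdd y) = c := D.logMulEquiv_eq_iff c y

end LogData

/-! ### The lattice `Λ` -/

lemma exists_unit_of_valuation_eq_one (α : Fˣ) (h : ∀ p : Primes F, p.valuation F (α : F) = 1) :
    ∃ u : (𝓞 F)ˣ, algebraMap (𝓞 F) F u = (α : F) := by
  obtain ⟨a, ha⟩ := HeightOneSpectrum.mem_integers_of_valuation_le_one F (α : F) fun p => (h p).le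
  obtain ⟨b, hb⟩ := HeightOneSpectrum.mem_integers_of_valuation_le_one F ((α : F)⁻¹) fun p => by
    rw [map_inv₀, h p, inv_one]
  refine ⟨Units.mkOfMulEqOne a b ?_, ha⟩
  refine RingOfIntegers.ext ?_
  simp only [map_mul, map_one]
  rw [ha, hb, mul_inv_cancel₀ α.ne_zero]

lemma valuation_unit (u : (𝓞 F)ˣ) (p : Primes F) :
    p.valuation F (algebraMap (𝓞 F) F u) = 1 := by
  have h1 : p.valuation F (algebraMap (𝓞 F) F (u : 𝓞 F)) ≤ 1 := p.valuation_le_one _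
  have h2 : p.valuation F (algebraMap (𝓞 F) F ((u⁻¹ : (𝓞 F)ˣ) : 𝓞 F)) ≤ 1 := p.valuation_le_one _
  refine eq_one_of_one_le_mul_left h1 h2 ?_
  rw [← map_mul, ← map_mul, Units.mul_inv, map_one, map_one]

namespace LogData

variable {m : Modulus F} (D : LogData m)

variable {D} in
/-- The equations expressing that `y` is a logarithm of the principal idèle of `α`. -/
lemma logS_principal_eq {α : Fˣ} {y : D.M}
    (h : D.logS (principal α) = Multiplicative.ofAdd (D.proj y)) :
    (∀ p : D.S, ord p.1 (finComp p.1 (principal α)) = y.1.1 p) ∧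
      (∀ σ : InfinitePlace F, (σ.mult : ℝ) / (2 * Real.pi) * Real.log (σ (α : F)) = y.2.1 σ) := by
  rw [logS_apply, Multiplicative.ofAdd.apply_eq_iff_eq] at h
  refine ⟨fun p => congrFun (congrArg (fun q => q.1.1) h) p, fun σ => ?_⟩
  have := congrFun (congrArg (fun q => q.2.1) h) σ
  rw [← norm_infComp_principal]
  exact this

lemma valuation_eq_one_of_logS {α : Fˣ} {y : D.M} (hα : principal α ∈ D.US)
    (h : D.logS (principal α) = Multiplicative.ofAdd (D.proj y)) (hy : y.1.1 = 0) (p : Primes F) :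
    p.valuation F (α : F) = 1 := by
  rw [← valued_finComp_principal]
  refine D.units_of_mem_US hα (fun p => ?_) p
  rw [(logS_principal_eq h).1, hy]; rfl

/-- An element of `Λ` close to `0` is the logarithm of a unit all of whose conjugates are bounded,
and there are only finitely many of those. -/
instance discreteTopology_Lam : DiscreteTopology D.Lam := by
  have hpi := Real.pi_pos
  let W : Set D.Lam := {y | y.1.1 = 0 ∧ (∀ σ, |y.1.2.1 σ| < 1) ∧ ∀ σ, |y.1.2.2 σ| < 1 / 2}
  have hWopen : IsOpen W := by
    have h1 : IsOpen {y : D.M | y.1 = 0} := (isOpen_discrete {0}).preimage continuous_fst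
    have h2 : IsOpen {y : D.M | ∀ σ, |y.2.1 σ| < 1} := by
      simp only [Set.ofPred_forall]
      exact isOpen_iInter_of_finite fun σ => isOpen_lt (by fun_prop) continuous_const
    have h3 : IsOpen {y : D.M | ∀ σ, |y.2.2 σ| < 1 / 2} := by
      simp only [Set.ofPred_forall]
      exact isOpen_iInter_of_finite fun σ => isOpen_lt (by fun_prop) continuous_const
    exact (h1.inter (h2.inter h3)).preimage continuous_subtype_val
  have hWfin : W.Finite := by
    choose α hα hlog using fun y : D.Lam => D.mem_Lam.1 y.2
    refine Set.Finite.of_injOn (f := fun y => (α y : F)) (t := _) ?_ ?_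
      (Embeddings.finite_of_norm_le F ℂ (Real.exp (2 * Real.pi)))
    · rintro y ⟨hy1, hy2, -⟩
      obtain ⟨u, hu⟩ := exists_unit_of_valuation_eq_one (α y)
        (D.valuation_eq_one_of_logS (hα y) (hlog y) (congrArg Prod.fst hy1))
      refine ⟨by beta_reduce; rw [← hu]; exact RingOfIntegers.isIntegral_coe _, fun φ => ?_⟩
      have h1 := (logS_principal_eq (hlog y)).2 (InfinitePlace.mk φ)
      have h2 := (le_abs_self _).trans_lt (hy2 (InfinitePlace.mk φ))
      have h3 : 0 < InfinitePlace.mk φ (α y : F) := (InfinitePlace.pos_iff).2 (α y).ne_zero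
      have h4 : (1 : ℝ) ≤ (InfinitePlace.mk φ).mult := by
        exact_mod_cast InfinitePlace.one_le_mult
      rw [← InfinitePlace.apply φ, ← Real.log_le_iff_le_exp h3]
      rw [← h1, div_mul_eq_mul_div, div_lt_one (by positivity)] at h2
      rcases le_or_gt 0 (Real.log (InfinitePlace.mk φ (α y : F))) with h5 | h5
      · nlinarith
      · linarith
    -- the unit determines `y` because the arguments are bounded by less than half a period
    · rintro y ⟨hy1, -, hy3⟩ y' ⟨hy1', -, hy3'⟩ hyy'
      have h1 : D.proj y.1 = D.proj y'.1 := by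
        have h2 := hlog y
        rw [Units.ext hyy', hlog y'] at h2
        exact (Multiplicative.ofAdd.injective h2).symm
      refine Subtype.ext (Prod.ext (hy1.trans hy1'.symm) (Prod.ext ?_ (funext fun σ => ?_)))
      · exact congrArg (fun q : D.MQuot => q.2.1) h1
      · have h2 : ((y.1.2.2 σ : ℝ) : UnitAddCircle) = (y'.1.2.2 σ : ℝ) :=
          congrFun (congrArg (fun q : D.MQuot => q.2.2) h1) σ
        rw [← sub_eq_zero, ← AddCircle.coe_sub, AddCircle.coe_eq_zero_iff] at h2
        obtain ⟨n, hn⟩ := h2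
        rw [zsmul_one] at hn
        have h3 := abs_lt.1 (hy3 σ)
        have h4 := abs_lt.1 (hy3' σ)
        have h5 : n = 0 := by
          have h6 : (n : ℝ) < 1 := by linarith
          have h7 : (-1 : ℝ) < n := by linarith
          have h8 : n < 1 := by exact_mod_cast h6
          have h9 : -1 < n := by exact_mod_cast h7
          omega
        rw [h5, Int.cast_zero] at hn
        linarith
  refine discreteTopology_of_isOpen_singleton_zero ?_
  -- the finite set `W \ {0}` is closed, so removing it from `W` leaves the open set `{0}`
  have h0 : ({0} : Set D.Lam) = W \ (W \ {0}) := by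
    rw [Set.sdiff_sdiff_cancel_left]
    rw [Set.singleton_subset_iff]
    refine ⟨rfl, fun σ => ?_, fun σ => ?_⟩
    · change |(0 : ℝ)| < 1; simp
    · change |(0 : ℝ)| < 1 / 2; simp
  rw [h0]
  exact hWopen.sdiff (hWfin.subset Set.sdiff_subset).isClosed

end LogData

/-! ### The rank of `Λ` -/

section Rank

variable {A B : Type*} [AddCommGroup A] [AddCommGroup B]

/-- If `A` and `B` embed into each other and `B` is finitely generated, then they have the same
rank. -/
lemma finite_and_finrank_eq_of_injective [Module.Finite ℤ B] (f : A →ₗ[ℤ] B) (g : B →ₗ[ℤ] A)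
    (hf : Function.Injective f) (hg : Function.Injective g) :
    Module.Finite ℤ A ∧ Module.finrank ℤ A = Module.finrank ℤ B := by
  have h : Module.Finite ℤ A := Module.Finite.of_injective f hf
  exact ⟨h, le_antisymm (LinearMap.finrank_le_finrank_of_injective hf)
    (LinearMap.finrank_le_finrank_of_injective hg)⟩

lemma finite_and_finrank_eq_range_add_ker (f : A →ₗ[ℤ] B) [Module.Finite ℤ (LinearMap.range f)]
    [Module.Finite ℤ (LinearMap.ker f)] : Module.Finite ℤ A ∧ Module.finrank ℤ A =
      Module.finrank ℤ (LinearMap.range f) + Module.finrank ℤ (LinearMap.ker f) := by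
  have h1 : Module.Finite ℤ (A ⧸ LinearMap.ker f) :=
    Module.Finite.equiv f.quotKerEquivRange.symm
  have h : Module.Finite ℤ A := Module.Finite.of_submodule_quotient (LinearMap.ker f)
  exact ⟨h, by rw [← f.quotKerEquivRange.finrank_eq, Submodule.finrank_quotient_add_finrank]⟩

end Rank

namespace LogData

variable {m : Modulus F} (D : LogData m)

/-- The projection of `Λ` to `ℤ^S`. -/
def lamToPrimes : D.Lam →ₗ[ℤ] (D.S → ℤ) :=
  ((AddMonoidHom.fst _ _).comp ((AddMonoidHom.fst _ _).comp D.Lam.subtype)).toIntLinearMap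

lemma lamToPrimes_apply (y : D.Lam) : D.lamToPrimes y = y.1.1.1 := rfl

lemma exists_mem_Lam_of_mem_US {α : Fˣ} (hα : principal α ∈ D.US) : ∃ y ∈ D.Lam,
    D.logS (principal α) = Multiplicative.ofAdd (D.proj y) := by
  obtain ⟨y, hy⟩ := D.proj_surjective (D.logS (principal α)).toAdd
  have h : D.logS (principal α) = Multiplicative.ofAdd (D.proj y) := by rw [hy]; rfl
  exact ⟨y, D.mem_Lam.2 ⟨α, hα, h⟩, h⟩

/-- The valuations of `S`-units have rank `|S|`: a power of each prime of `S` is generated by an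
`S`-unit. -/
lemma finrank_range_lamToPrimes : Module.finrank ℤ (LinearMap.range D.lamToPrimes) = D.S.card := by
  classical
  choose n hn α hα using fun p : D.S => exists_principal_power p.1
  have hmem : ∀ p : D.S, (Pi.single p (n p : ℤ) : D.S → ℤ) ∈ LinearMap.range D.lamToPrimes := by
    intro p
    have h1 : principal (α p) ∈ D.US := fun q hq => by
      have h2 : q ≠ p.1 := fun h => hq (h.symm ▸ p.2)
      rw [valued_finComp_principal, hα, if_neg h2]; simp
    obtain ⟨y, hy, h⟩ := D.exists_mem_Lam_of_mem_US h1
    refine ⟨⟨y, hy⟩, funext fun q => ?_⟩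
    rw [lamToPrimes_apply, ← (logS_principal_eq h).1 q]
    have h2 := valued_eq_exp_ord q.1 (finComp q.1 (principal (α p)))
    rw [valued_finComp_principal, hα, WithZero.exp_inj, neg_inj] at h2
    rw [← h2, Pi.single_apply]
    simp only [Subtype.ext_iff]
  let g : (D.S → ℤ) →ₗ[ℤ] LinearMap.range D.lamToPrimes :=
    Fintype.linearCombination ℤ fun p => ⟨_, hmem p⟩
  have hg : ∀ a q, ((g a : LinearMap.range D.lamToPrimes) : D.S → ℤ) q = a q * n q := by
    intro a q
    simp [g, Fintype.linearCombination_apply, Finset.sum_apply, Pi.single_apply]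
  have := (finite_and_finrank_eq_of_injective (LinearMap.range D.lamToPrimes).subtype g
    Subtype.val_injective fun a b hab => funext fun q => ?_).2
  · rw [this]; simp
  · have h1 := congrFun (congrArg Subtype.val hab) q
    rw [hg, hg] at h1
    exact mul_right_cancel₀ (by exact_mod_cast (hn q).ne') h1

/-- The archimedean coordinates, except for one place, on the kernel of `lamToPrimes`, normalized
as in Dirichlet's unit theorem. -/
def lamToLogSpace : LinearMap.ker D.lamToPrimes →ₗ[ℤ] Units.dirichletUnitTheorem.logSpace F :=
  AddMonoidHom.toIntLinearMap
    { toFun := fun y w => 2 * Real.pi * y.1.1.2.1 w.1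
      map_zero' := funext fun _ => mul_zero _
      map_add' := fun _ _ => funext fun _ => mul_add _ _ _ }

lemma exists_unit_of_mem_ker (y : LinearMap.ker D.lamToPrimes) : ∃ u : (𝓞 F)ˣ,
    principal (Units.map (algebraMap (𝓞 F) F).toMonoidHom u) ∈ D.US ∧
    D.logS (principal (Units.map (algebraMap (𝓞 F) F).toMonoidHom u)) =
      Multiplicative.ofAdd (D.proj y.1.1) := by
  obtain ⟨α, hα, h⟩ := D.mem_Lam.1 y.1.2
  obtain ⟨u, hu⟩ := exists_unit_of_valuation_eq_one α
    (D.valuation_eq_one_of_logS hα h y.2)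
  obtain rfl : Units.map (algebraMap (𝓞 F) F).toMonoidHom u = α := Units.ext hu
  exact ⟨u, hα, h⟩

lemma logEmbedding_eq {u : (𝓞 F)ˣ} {y : D.M}
    (h : D.logS (principal (Units.map (algebraMap (𝓞 F) F).toMonoidHom u)) =
      Multiplicative.ofAdd (D.proj y)) (w) :
    Units.logEmbedding F (Additive.ofMul u) w = 2 * Real.pi * y.2.1 w.1 := by
  have hpi := Real.pi_pos
  rw [Units.dirichletUnitTheorem.logEmbedding_component, ← (logS_principal_eq h).2 w.1]
  change _ = 2 * Real.pi * (_ * Real.log (w.1 (algebraMap (𝓞 F) F u)))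
  field_simp

/-- On the elements of `Λ` with trivial valuations, the archimedean coordinates are those of the
logarithmic embedding of the units. -/
lemma range_lamToLogSpace : LinearMap.range D.lamToLogSpace = Units.unitLattice F := by
  ext v
  constructor
  · rintro ⟨y, rfl⟩
    obtain ⟨u, -, h⟩ := D.exists_unit_of_mem_ker y
    exact ⟨Additive.ofMul u, trivial, funext fun w => D.logEmbedding_eq h w⟩
  · rintro ⟨u, -, rfl⟩
    have h1 : ∀ p, Valued.v (finComp p (principal (Units.map (algebraMap (𝓞 F) F).toMonoidHom
        u.toMul)) : p.adicCompletion F) = 1 := fun p => by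
      rw [valued_finComp_principal]
      exact valuation_unit _ p
    obtain ⟨y, hy, h⟩ := D.exists_mem_Lam_of_mem_US (D.mem_US_of_units h1)
    refine ⟨⟨⟨y, hy⟩, ?_⟩, funext fun w => (D.logEmbedding_eq h w).symm⟩
    rw [LinearMap.mem_ker, lamToPrimes_apply]
    funext p
    rw [← (logS_principal_eq h).1 p]
    exact (ord_eq_zero_iff _ _).2 (h1 _)

/-- The subgroup `Λ_𝔪 × ℤ^{r₂}` of `ℤ^r × ℝ^{r₂}`. -/
def torsionLattice : AddSubgroup ((Fin D.r → ℤ) × (ComplexPlace F → ℝ)) :=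
  D.relations.prod ((Int.castAddHom ℝ).compLeft (ComplexPlace F)).range

lemma mem_torsionLattice_iff (b : Fin D.r → ℤ) (θ : ComplexPlace F → ℝ) :
    (b, θ) ∈ D.torsionLattice ↔ D.proj ((0, b), (0, θ)) = 0 := by
  rw [torsionLattice, AddSubgroup.mem_prod, Prod.ext_iff, Prod.ext_iff, Prod.ext_iff]
  refine ⟨fun ⟨h1, h2⟩ => ⟨⟨rfl, (QuotientAddGroup.eq_zero_iff _).2 h1⟩, rfl, ?_⟩,
    fun ⟨⟨_, h1⟩, _, h2⟩ => ⟨(QuotientAddGroup.eq_zero_iff _).1 h1, ?_⟩⟩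
  · obtain ⟨k, hk⟩ := h2
    funext σ
    exact (AddCircle.coe_eq_zero_iff _).2 ⟨k σ, by rw [zsmul_one]; exact congrFun hk σ⟩
  · choose k hk using fun σ => (AddCircle.coe_eq_zero_iff (1 : ℝ)).1 (congrFun h2 σ)
    exact ⟨k, funext fun σ => (zsmul_one (k σ)).symm.trans (hk σ)⟩

lemma finite_and_finrank_torsionLattice : Module.Finite ℤ D.torsionLattice ∧
    Module.finrank ℤ D.torsionLattice = D.r + InfinitePlace.nrComplexPlaces F := by
  classical
  have := D.relations_full
  have hinj : Function.Injective ((Int.castAddHom ℝ).compLeft (ComplexPlace F)) := fun a b h =>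
    funext fun σ => Int.cast_injective (α := ℝ) (congrFun h σ)
  let e : D.torsionLattice ≃+ D.relations × (ComplexPlace F → ℤ) :=
    (AddSubgroup.prodEquiv _ _).trans
      ((AddEquiv.refl _).prodCongr (AddMonoidHom.ofInjective hinj).symm)
  have h1 := (e.toIntLinearEquiv).finrank_eq
  refine ⟨Module.Finite.equiv e.toIntLinearEquiv.symm, h1.trans ?_⟩
  rw [Module.finrank_prod, AddSubgroup.finrank_eq_of_finiteIndex, Module.finrank_fin_fun,
    Module.finrank_fintype_fun_eq_card]

/-- An element of `Λ` whose valuations and absolute values are trivial is the logarithm of a root of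
unity, so a multiple of it lies in `Λ_𝔪 + ℤ^{r₂}`. -/
lemma torsion_of_mem_ker (y : LinearMap.ker D.lamToLogSpace) : y.1.1.1.2.1 = 0 ∧
    Nat.card (Units.torsion F) • (y.1.1.1.1.2, y.1.1.1.2.2) ∈ D.torsionLattice := by
  obtain ⟨u, hu, h⟩ := D.exists_unit_of_mem_ker y.1
  have h1 : u ∈ Units.torsion F := by
    rw [← Units.dirichletUnitTheorem.logEmbedding_eq_zero_iff]
    funext w
    rw [D.logEmbedding_eq h w]
    exact congrFun y.2 w
  have h3 : y.1.1.1.2.1 = 0 := by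
    funext σ
    rw [← (logS_principal_eq h).2 σ]
    change _ * Real.log (σ (algebraMap (𝓞 F) F u)) = 0
    rw [((Units.mem_torsion F).1 h1 σ), Real.log_one, mul_zero]
  refine ⟨h3, ?_⟩
  have h2 : u ^ Nat.card (Units.torsion F) = 1 :=
    congrArg Subtype.val (pow_card_eq_one' (x := (⟨u, h1⟩ : Units.torsion F)))
  have h4 : D.proj (Nat.card (Units.torsion F) • y.1.1.1) = 0 := by
    have := congrArg (· ^ Nat.card (Units.torsion F)) h
    simp only [← map_pow, h2, map_one, ← ofAdd_nsmul, ← map_nsmul] at this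
    exact this.symm
  change (Nat.card (Units.torsion F) • y.1.1.1.1.2, Nat.card (Units.torsion F) • y.1.1.1.2.2) ∈ _
  rw [mem_torsionLattice_iff, ← h4]
  congr 1
  refine Prod.ext (Prod.ext ?_ rfl) (Prod.ext ?_ rfl)
  · have : y.1.1.1.1.1 = 0 := y.1.2
    simp [this]
  · simp [h3]

lemma finite_and_finrank_ker_lamToLogSpace : Module.Finite ℤ (LinearMap.ker D.lamToLogSpace) ∧
    Module.finrank ℤ (LinearMap.ker D.lamToLogSpace) = D.r + InfinitePlace.nrComplexPlaces F := by
  have := D.finite_and_finrank_torsionLattice.1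
  rw [← D.finite_and_finrank_torsionLattice.2]
  have hmem : ∀ z ∈ D.torsionLattice, (((0, z.1), (0, z.2)) : D.M) ∈ D.Lam := fun z hz =>
    D.mem_Lam.2 ⟨1, by rw [map_one]; exact one_mem _, by
      rw [(D.mem_torsionLattice_iff z.1 z.2).1 hz, map_one, map_one, ofAdd_zero]⟩
  -- multiplication by the number of roots of unity embeds the kernel into `Λ_𝔪 × ℤ^{r₂}`, which is
  -- itself contained in the kernel
  refine finite_and_finrank_eq_of_injective
    (AddMonoidHom.toIntLinearMap (AddMonoidHom.mk' (fun y => ⟨_, (D.torsion_of_mem_ker y).2⟩) ?_))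
    (AddMonoidHom.toIntLinearMap (AddMonoidHom.mk'
      (fun z => ⟨⟨⟨((0, z.1.1), (0, z.1.2)), hmem z.1 z.2⟩, ?_⟩, ?_⟩) ?_)) ?_ ?_
  · intro a b
    exact Subtype.ext (smul_add _ (a.1.1.1.1.2, a.1.1.1.2.2) (b.1.1.1.1.2, b.1.1.1.2.2))
  · rfl
  · funext w
    exact mul_zero _
  · intro a b
    refine Subtype.ext (Subtype.ext (Subtype.ext (Prod.ext (Prod.ext ?_ rfl) (Prod.ext ?_ rfl))))
    · exact (add_zero _).symm
    · exact (add_zero _).symm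
  · intro y y' h
    have h1 := smul_right_injective _ (Nat.card_pos (α := Units.torsion F)).ne'
      (congrArg Subtype.val h)
    refine Subtype.ext (Subtype.ext (Subtype.ext (Prod.ext (Prod.ext ?_ ?_) (Prod.ext ?_ ?_))))
    · exact y.1.2.trans y'.1.2.symm
    · exact (Prod.ext_iff.1 h1).1
    · rw [(D.torsion_of_mem_ker y).1, (D.torsion_of_mem_ker y').1]
    · exact (Prod.ext_iff.1 h1).2
  · intro z z' h
    have h1 := congrArg (fun q => (q.1.1.1.1.2, q.1.1.1.2.2)) h
    exact Subtype.ext h1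

/-- The rank of `Λ` is the sum of the ranks of the valuations of `S`-units, of the units and of
`Λ_𝔪 + ℤ^{r₂}`, that is `|S| + (r₁ + r₂ - 1) + (r + r₂)`. -/
lemma finite_and_finrank_Lam : Module.Finite ℤ D.Lam ∧
    Module.finrank ℤ D.Lam = D.ell + Module.finrank ℚ F - 1 := by
  classical
  have h1 := D.finite_and_finrank_ker_lamToLogSpace
  have := h1.1
  have h2 : Module.Finite ℤ (LinearMap.range D.lamToLogSpace) := by
    rw [range_lamToLogSpace]; infer_instance
  have h3 := finite_and_finrank_eq_range_add_ker D.lamToLogSpace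
  rw [range_lamToLogSpace, Units.unitLattice_rank, h1.2] at h3
  have := h3.1
  have h4 := finite_and_finrank_eq_range_add_ker D.lamToPrimes
  rw [h3.2, finrank_range_lamToPrimes] at h4
  refine ⟨h4.1, h4.2.trans ?_⟩
  have h5 := InfinitePlace.card_add_two_mul_card_eq_rank F
  have h6 := InfinitePlace.card_eq_nrRealPlaces_add_nrComplexPlaces F
  have h7 : 0 < Fintype.card (InfinitePlace F) := Fintype.card_pos
  rw [ell, Units.rank]
  omega

lemma free_Lam : Module.Free ℤ D.Lam := by
  have := D.finite_and_finrank_Lam.1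
  infer_instance

end LogData

/-! ### Characters of `ℤ^ℓ × ℝ^n` -/

/-- A continuous character of `ℝ` is of the form `x ↦ exp (2πi a x)`: it is a multiple of the
differentiable function `x ↦ ∫_x^{x+δ} χ`, and therefore satisfies `χ' = χ'(0) χ`. -/
lemma exists_eq_circle_exp {f : ℝ → Circle} (hc : Continuous f)
    (hf : ∀ x y, f (x + y) = f x * f y) :
    ∃ a : ℝ, ∀ x, f x = Circle.exp (2 * Real.pi * (a * x)) := by
  have hpi := Real.pi_pos
  let χ : ℝ → ℂ := fun x => f x
  have hχc : Continuous χ := by fun_prop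
  have hχ : ∀ x y, χ (x + y) = χ x * χ y := fun x y => by simp [χ, hf]
  have hχ0 : χ 0 = 1 := by
    have h := hχ 0 0
    rw [add_zero] at h
    exact (mul_eq_left₀ (Circle.coe_ne_zero _)).1 h.symm
  let I : ℝ → ℂ := fun x => ∫ t in (0 : ℝ)..x, χ t
  have hI : ∀ x, HasDerivAt I (χ x) x := fun x => hχc.integral_hasStrictDerivAt 0 x |>.hasDerivAt
  obtain ⟨δ, hδ⟩ : ∃ δ, I δ ≠ 0 := by
    by_contra! h
    have h1 : I = fun _ => 0 := funext h
    have h2 := hI 0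
    rw [h1, hχ0] at h2
    exact one_ne_zero (h2.unique (hasDerivAt_const 0 0))
  have hconv : ∀ x, χ x = (I (x + δ) - I x) / I δ := by
    intro x
    rw [eq_div_iff hδ]
    have h1 : I (x + δ) - I x = ∫ t in x..(x + δ), χ t :=
      intervalIntegral.integral_interval_sub_left (hχc.intervalIntegrable _ _)
        (hχc.intervalIntegrable _ _)
    have h2 := intervalIntegral.integral_comp_add_left (a := 0) (b := δ) χ x
    rw [add_zero] at h2
    rw [h1, ← h2]
    simp only [hχ, intervalIntegral.integral_const_mul]
    rfl
  have hderiv0 : ∃ c, HasDerivAt χ c 0 := by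
    rw [funext hconv]
    exact ⟨_, (((hI (0 + δ)).comp_add_const 0 δ).sub (hI 0)).div_const (I δ)⟩
  obtain ⟨c, hc0⟩ := hderiv0
  have hderiv : ∀ x, HasDerivAt χ (χ x * c) x := by
    intro x
    have h1 : χ = fun y => χ x * χ (y - x) := funext fun y => by rw [← hχ, add_sub_cancel]
    rw [h1]
    have h2 : HasDerivAt χ c (x - x) := by rwa [sub_self]
    have h3 := (h2.comp_sub_const x x).const_mul (χ x)
    simpa [hχ0] using h3
  have hexp : ∀ x : ℝ, χ x = Complex.exp (c * x) := by
    have h1 : ∀ x : ℝ, HasDerivAt (fun y : ℝ => χ y * Complex.exp (-(c * y))) 0 x := by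
      intro x
      have h2 : HasDerivAt (fun y : ℝ => Complex.exp (-(c * y)))
          (Complex.exp (-(c * x)) * -(c * 1)) x :=
        (((hasDerivAt_id (x : ℝ)).ofReal_comp.const_mul c).neg).cexp
      exact ((hderiv x).mul h2).congr_deriv (by ring)
    intro x
    have h2 := is_const_of_deriv_eq_zero (fun x => (h1 x).differentiableAt)
      (fun x => (h1 x).deriv) x 0
    simp only [hχ0, Complex.ofReal_zero, mul_zero, neg_zero, Complex.exp_zero, mul_one] at h2
    rw [Complex.exp_neg, mul_inv_eq_one₀ (Complex.exp_ne_zero _)] at h2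
    exact h2
  have hre : c.re = 0 := by
    have h1 : ‖χ 1‖ = 1 := Circle.norm_coe _
    rw [hexp, Complex.norm_exp] at h1
    simpa using h1
  refine ⟨c.im / (2 * Real.pi), fun x => Circle.ext ?_⟩
  rw [Circle.coe_exp]
  refine (hexp x).trans (congrArg Complex.exp ?_)
  have h1 : c = c.im * Complex.I := by
    apply Complex.ext <;> simp [hre]
  rw [show 2 * Real.pi * (c.im / (2 * Real.pi) * x) = c.im * x by field_simp]
  conv_lhs => rw [h1]
  push_cast
  ring

lemma circle_exp_two_pi_eq_one_iff (t : ℝ) :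
    Circle.exp (2 * Real.pi * t) = 1 ↔ ∃ k : ℤ, t = k := by
  have hpi := Real.pi_pos
  rw [Circle.exp_eq_one]
  refine exists_congr fun k => ⟨fun h => ?_, fun h => by rw [h]; ring⟩
  have : 2 * Real.pi * t = 2 * Real.pi * k := by rw [h]; ring
  exact mul_left_cancel₀ (by positivity) this

lemma circle_exp_arg (z : Circle) :
    Circle.exp (2 * Real.pi * (Complex.arg z / (2 * Real.pi))) = z := by
  rw [mul_div_cancel₀ _ (by positivity)]
  exact Circle.exp_arg z

lemma eq_zero_of_forall_int {a : ℝ} (h : ∀ t : ℝ, ∃ k : ℤ, a * t = k) : a = 0 := by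
  by_contra ha
  obtain ⟨k, hk⟩ := h (1 / (2 * a))
  have h1 : (1 : ℝ) = 2 * k := by rw [← hk]; field_simp
  have h2 : (1 : ℤ) = 2 * k := by exact_mod_cast h1
  omega

namespace LogData

variable {m : Modulus F} (D : LogData m)

lemma pairing_add_right (w : D.V) (y y' : D.M) :
    D.pairing w (y + y') = D.pairing w y + D.pairing w y' := by
  simp only [pairing, Prod.fst_add, Prod.snd_add, Pi.add_apply, mul_add, Int.cast_add,
    Finset.sum_add_distrib]
  ring

lemma pairing_add_left (w w' : D.V) (y : D.M) :
    D.pairing (w + w') y = D.pairing w y + D.pairing w' y := by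
  simp only [pairing, Prod.fst_add, Prod.snd_add, Pi.add_apply, add_mul,
    Finset.sum_add_distrib]
  ring

lemma continuous_pairing : Continuous fun q : D.V × D.M => D.pairing q.1 q.2 := by
  have h1 : ∀ p, Continuous fun q : D.V × D.M => (q.2.1.1 p : ℝ) := fun p =>
    continuous_of_discreteTopology.comp
      ((continuous_apply p).comp (continuous_fst.comp (continuous_fst.comp continuous_snd)))
  have h2 : ∀ i, Continuous fun q : D.V × D.M => (q.2.1.2 i : ℝ) := fun i =>
    continuous_of_discreteTopology.comp
      ((continuous_apply i).comp (continuous_snd.comp (continuous_fst.comp continuous_snd)))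
  unfold pairing
  fun_prop

/-- The character `y ↦ exp (2πi w·y)` of `ℤ^ℓ × ℝ^n`. -/
def pairChar (w : D.V) : Multiplicative D.M →* Circle where
  toFun y := Circle.exp (2 * Real.pi * D.pairing w y.toAdd)
  map_one' := by
    have : D.pairing w 0 = 0 := by simpa using D.pairing_add_right w 0 0
    rw [toAdd_one, this, mul_zero, Circle.exp_zero]
  map_mul' y y' := by rw [toAdd_mul, pairing_add_right, mul_add, Circle.exp_add]

lemma pairChar_apply (w : D.V) (y : D.M) :
    D.pairChar w (Multiplicative.ofAdd y) = Circle.exp (2 * Real.pi * D.pairing w y) := rfl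

section Basis

variable (w : D.V)

open scoped Classical in
lemma pairing_single_prime (p : D.S) : D.pairing w ((Pi.single p 1, 0), 0) = w.1.1 p := by
  simp [pairing, Pi.single_apply]

open scoped Classical in
lemma pairing_single_modulus (i : Fin D.r) : D.pairing w ((0, Pi.single i 1), 0) = w.1.2 i := by
  simp [pairing, Pi.single_apply]

open scoped Classical in
lemma pairing_single_place (σ : InfinitePlace F) (t : ℝ) :
    D.pairing w (0, (Pi.single σ t, 0)) = w.2.1 σ * t := by
  simp [pairing, Pi.single_apply]

open scoped Classical in
lemma pairing_single_complexPlace (σ : ComplexPlace F) (t : ℝ) :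
    D.pairing w (0, (0, Pi.single σ t)) = w.2.2 σ * t := by
  simp [pairing, Pi.single_apply]

end Basis

open scoped Classical in
/-- A homomorphism from `ℤ^ℓ × ℝ^n` is determined by its values on the coordinate axes. -/
lemma monoidHom_ext {f g : Multiplicative D.M →* Circle}
    (h1 : ∀ p : D.S, f (Multiplicative.ofAdd ((Pi.single p 1, 0), 0)) =
      g (Multiplicative.ofAdd ((Pi.single p 1, 0), 0)))
    (h2 : ∀ i : Fin D.r, f (Multiplicative.ofAdd ((0, Pi.single i 1), 0)) =
      g (Multiplicative.ofAdd ((0, Pi.single i 1), 0)))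
    (h3 : ∀ (σ : InfinitePlace F) (t : ℝ), f (Multiplicative.ofAdd (0, (Pi.single σ t, 0))) =
      g (Multiplicative.ofAdd (0, (Pi.single σ t, 0))))
    (h4 : ∀ (σ : ComplexPlace F) (t : ℝ), f (Multiplicative.ofAdd (0, (0, Pi.single σ t))) =
      g (Multiplicative.ofAdd (0, (0, Pi.single σ t)))) : f = g := by
  refine MonoidHom.ext fun y => ?_
  let T : AddSubgroup D.M := Subgroup.toAddSubgroup' (f.eqLocus g)
  change y.toAdd ∈ T
  generalize y.toAdd = y
  have h : y = (∑ p : D.S, y.1.1 p • (((Pi.single p 1, 0), 0) : D.M)) +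
      (∑ i : Fin D.r, y.1.2 i • (((0, Pi.single i 1), 0) : D.M)) +
      (∑ σ : InfinitePlace F, ((0, (Pi.single σ (y.2.1 σ), 0)) : D.M)) +
      (∑ σ : ComplexPlace F, ((0, (0, Pi.single σ (y.2.2 σ))) : D.M)) := by
    refine Prod.ext (Prod.ext ?_ ?_) (Prod.ext ?_ ?_)
    · funext q
      simp [Prod.fst_sum, Finset.sum_apply, Pi.single_apply]
    · funext q
      simp [Prod.fst_sum, Prod.snd_sum, Finset.sum_apply, Pi.single_apply]
    · funext q
      simp [Prod.fst_sum, Prod.snd_sum, Finset.sum_apply, Pi.single_apply]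
    · funext q
      simp [Prod.snd_sum, Finset.sum_apply, Pi.single_apply]
  rw [h]
  exact add_mem (add_mem (add_mem (sum_mem fun p _ => zsmul_mem (h1 p) _)
    (sum_mem fun i _ => zsmul_mem (h2 i) _)) (sum_mem fun σ _ => h3 σ _))
    (sum_mem fun σ _ => h4 σ _)

/-- Every continuous character of `ℤ^ℓ × ℝ^n` is of the form `y ↦ exp (2πi w·y)`. -/
lemma exists_eq_pairChar {f : Multiplicative D.M →* Circle} (hf : Continuous f) :
    ∃ w, f = D.pairChar w := by
  classical
  have h3 : ∀ σ : InfinitePlace F, ∃ a : ℝ, ∀ t : ℝ,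
      f (Multiplicative.ofAdd (0, (Pi.single σ t, 0))) = Circle.exp (2 * Real.pi * (a * t)) := by
    intro σ
    refine exists_eq_circle_exp (hf.comp (continuous_ofAdd.comp ?_)) fun x y => ?_
    · exact continuous_const.prodMk
        ((continuous_single (A := fun _ : InfinitePlace F => ℝ) σ).prodMk continuous_const)
    · rw [← map_mul, ← ofAdd_add]
      simp [Pi.single_add]
  have h4 : ∀ σ : ComplexPlace F, ∃ a : ℝ, ∀ t : ℝ,
      f (Multiplicative.ofAdd (0, (0, Pi.single σ t))) = Circle.exp (2 * Real.pi * (a * t)) := by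
    intro σ
    refine exists_eq_circle_exp (hf.comp (continuous_ofAdd.comp ?_)) fun x y => ?_
    · exact continuous_const.prodMk (continuous_const.prodMk
        (continuous_single (A := fun _ : ComplexPlace F => ℝ) σ))
    · rw [← map_mul, ← ofAdd_add]
      simp [Pi.single_add]
  choose φ hφ using h3
  choose k hk using h4
  refine ⟨((fun p => Complex.arg (f (Multiplicative.ofAdd ((Pi.single p 1, 0), 0))) / (2 * Real.pi),
    fun i => Complex.arg (f (Multiplicative.ofAdd ((0, Pi.single i 1), 0))) / (2 * Real.pi)),
    (φ, k)), D.monoidHom_ext ?_ ?_ ?_ ?_⟩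
  · intro p
    rw [pairChar_apply, pairing_single_prime, circle_exp_arg]
  · intro i
    rw [pairChar_apply, pairing_single_modulus, circle_exp_arg]
  · intro σ t
    rw [pairChar_apply, pairing_single_place, hφ]
  · intro σ t
    rw [pairChar_apply, pairing_single_complexPlace, hk]

lemma pairChar_eq_one_iff (w : D.V) : D.pairChar w = 1 ↔ w ∈ D.ZEll := by
  classical
  constructor
  · intro h
    have h0 : ∀ y, ∃ k : ℤ, D.pairing w y = k := fun y => by
      rw [← circle_exp_two_pi_eq_one_iff, ← pairChar_apply, h]; rfl
    choose a ha using fun p => h0 ((Pi.single p 1, 0), 0)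
    choose b hb using fun i => h0 ((0, Pi.single i 1), 0)
    refine ⟨⟨(a, b), Prod.ext (funext fun p => ?_) (funext fun i => ?_)⟩,
      Prod.ext (funext fun σ => ?_) (funext fun σ => ?_)⟩
    · exact (ha p).symm.trans (D.pairing_single_prime w p)
    · exact (hb i).symm.trans (D.pairing_single_modulus w i)
    · refine eq_zero_of_forall_int fun t => ?_
      rw [← pairing_single_place]; exact h0 _
    · refine eq_zero_of_forall_int fun t => ?_
      rw [← pairing_single_complexPlace]; exact h0 _
  · rintro ⟨⟨⟨a, b⟩, hab⟩, h⟩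
    obtain ⟨w1, w2⟩ := w
    obtain rfl : _ = w1 := hab
    obtain rfl : w2 = 0 := h
    refine D.monoidHom_ext ?_ ?_ ?_ ?_
    · intro p
      rw [pairChar_apply, pairing_single_prime]
      exact (circle_exp_two_pi_eq_one_iff _).2 ⟨a p, rfl⟩
    · intro i
      rw [pairChar_apply, pairing_single_modulus]
      exact (circle_exp_two_pi_eq_one_iff _).2 ⟨b i, rfl⟩
    · intro σ t
      rw [pairChar_apply, pairing_single_place]; simp
    · intro σ t
      rw [pairChar_apply, pairing_single_complexPlace]; simp

lemma mem_LamPerp_iff (w : D.V) :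
    w ∈ D.LamPerp ↔ ∀ y ∈ D.Lam, D.pairChar w (Multiplicative.ofAdd y) = 1 :=
  forall₂_congr fun y _ => (circle_exp_two_pi_eq_one_iff (D.pairing w y)).symm

end LogData

/-! ### The isomorphism `ℒ*` -/

namespace LogData

variable {m : Modulus F} (D : LogData m)

lemma locallyCompactSpace_C (D : LogData m) : LocallyCompactSpace (C m) := by
  have h : LocallyCompactSpace (D.M ⧸ D.Lam) := inferInstance
  have h' : LocallyCompactSpace (Multiplicative (D.M ⧸ D.Lam)) := h
  exact D.logEquiv.toHomeomorph.isOpenEmbedding.locallyCompactSpace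

lemma isOpenQuotientMap_expC : IsOpenQuotientMap D.expC := by
  have h : (D.expC : Multiplicative D.M → C m) =
      D.logEquiv.toHomeomorph.symm ∘ fun y => Multiplicative.ofAdd (QuotientAddGroup.mk y.toAdd) :=
    funext fun y => (D.logEquiv.toHomeomorph.symm_apply_eq.2
      ((D.logEquiv_eq_iff _ y.toAdd).2 rfl).symm).symm
  refine ⟨D.expC_surjective, D.continuous_expC, ?_⟩
  rw [h]
  exact D.logEquiv.toHomeomorph.symm.isOpenMap.comp
    (QuotientAddGroup.isOpenMap_coe (N := D.Lam))

/-- The character of `C_𝔪` with `χ(x) = exp (2πi w·ℒ(x))`. -/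
def dualChar (w : D.LamPerp) : PontryaginDual (C m) :=
  show C m →ₜ* Circle from
  { toMonoidHom := (quotientLift D.Lam (D.pairChar w)
      ((D.mem_LamPerp_iff w).1 w.2)).comp D.logEquiv.toMulEquiv.toMonoidHom
    continuous_toFun := by
      refine Continuous.comp (g := quotientLift D.Lam (D.pairChar w)
        ((D.mem_LamPerp_iff w).1 w.2)) ?_ D.logEquiv.continuous_toFun
      have h : Continuous fun q : D.M ⧸ D.Lam => quotientLift D.Lam (D.pairChar w)
          ((D.mem_LamPerp_iff w).1 w.2) (Multiplicative.ofAdd q) := by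
        refine (QuotientAddGroup.isQuotientMap_mk D.Lam).continuous_iff.2 ?_
        exact Circle.exp.continuous.comp (continuous_const.mul
          (D.continuous_pairing.comp (continuous_const.prodMk continuous_id)))
      exact h.comp continuous_toAdd }

lemma dualChar_expC (w : D.LamPerp) (y : Multiplicative D.M) :
    D.dualChar w (D.expC y) = D.pairChar w y := by
  have h := (D.logEquiv_eq_iff (D.expC y) y.toAdd).2 rfl
  change quotientLift D.Lam (D.pairChar w) _ (D.logEquiv (D.expC y)) = _
  rw [h]; rfl

lemma dualChar_eq_iff (w : D.LamPerp) (χ : PontryaginDual (C m)) :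
    D.dualChar w = χ ↔ ∀ y, χ (D.expC y) = D.pairChar w y := by
  refine ⟨fun h y => by rw [← h, dualChar_expC], fun h => PontryaginDual.ext fun c => ?_⟩
  obtain ⟨y, rfl⟩ := D.expC_surjective c
  rw [dualChar_expC, h]

lemma pairChar_add (w w' : D.V) : D.pairChar (w + w') = D.pairChar w * D.pairChar w' := by
  refine MonoidHom.ext fun y => ?_
  change Circle.exp _ = Circle.exp _ * Circle.exp _
  rw [← Circle.exp_add, pairing_add_left, mul_add]

/-- The homomorphism `Λ^⊥ → Ĉ_𝔪`. -/
def dualHom : Multiplicative D.LamPerp →* PontryaginDual (C m) :=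
  MonoidHom.mk' (fun w => D.dualChar w.toAdd) fun w w' => by
    rw [dualChar_eq_iff]
    intro y
    change D.dualChar w.toAdd (D.expC y) * D.dualChar w'.toAdd (D.expC y) = _
    rw [dualChar_expC, dualChar_expC, toAdd_mul, AddSubgroup.coe_add, pairChar_add]
    rfl

lemma dualHom_apply (w : D.LamPerp) : D.dualHom (Multiplicative.ofAdd w) = D.dualChar w := rfl

lemma continuous_char (χ : PontryaginDual (C m)) : Continuous fun c : C m => χ c :=
  ContinuousMonoidHom.continuous_toFun (show C m →ₜ* Circle from χ)

lemma dualHom_surjective : Function.Surjective D.dualHom := by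
  intro χ
  let f : Multiplicative D.M →* Circle := MonoidHom.mk' (fun y => χ (D.expC y)) fun y y' => by
    rw [map_mul]
    exact map_mul (show C m →ₜ* Circle from χ) _ _
  obtain ⟨w, hw⟩ := D.exists_eq_pairChar (f := f) ((continuous_char χ).comp D.continuous_expC)
  have h1 : w ∈ D.LamPerp := by
    rw [mem_LamPerp_iff]
    intro y hy
    rw [← hw]
    change χ (D.expC _) = 1
    rw [(D.expC_eq_one_iff y).2 hy]
    exact map_one (show C m →ₜ* Circle from χ)
  refine ⟨Multiplicative.ofAdd ⟨w, h1⟩, (D.dualChar_eq_iff _ _).2 fun y => ?_⟩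
  exact DFunLike.congr_fun hw y

lemma dualHom_eq_one_iff (w : D.LamPerp) :
    D.dualHom (Multiplicative.ofAdd w) = 1 ↔ w ∈ D.ZEll.addSubgroupOf D.LamPerp := by
  rw [AddSubgroup.mem_addSubgroupOf, ← pairChar_eq_one_iff, dualHom_apply, dualChar_eq_iff,
    MonoidHom.ext_iff]
  exact forall_congr' fun y => eq_comm

lemma continuous_dualHom : Continuous D.dualHom := by
  -- for the compact-open topology it suffices that `(w, c) ↦ χ_w(c)` is continuous, which can be
  -- checked on `ℤ^ℓ × ℝ^n`
  refine (ContinuousMonoidHom.isInducing_toContinuousMap (C m) Circle).continuous_iff.2 ?_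
  refine ContinuousMap.continuous_of_continuous_uncurry _ ?_
  have hq : IsOpenQuotientMap (Prod.map (id : Multiplicative D.LamPerp → _) D.expC) :=
    IsOpenQuotientMap.prodMap .id D.isOpenQuotientMap_expC
  refine hq.isQuotientMap.continuous_iff.2 ?_
  have h : Continuous fun q : Multiplicative D.LamPerp × Multiplicative D.M =>
      Circle.exp (2 * Real.pi * D.pairing (q.1.toAdd : D.V) q.2.toAdd) :=
    Circle.exp.continuous.comp (continuous_const.mul (D.continuous_pairing.comp
      ((continuous_subtype_val.comp (continuous_toAdd.comp continuous_fst)).prodMk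
        (continuous_toAdd.comp continuous_snd))))
  refine h.congr fun q => ?_
  exact (D.dualChar_expC q.1.toAdd q.2).symm

lemma isClosed_LamPerp : IsClosed (D.LamPerp : Set D.V) := by
  have h : (D.LamPerp : Set D.V) =
      ⋂ y ∈ D.Lam, {w | D.pairChar w (Multiplicative.ofAdd y) = 1} := by
    ext w
    rw [SetLike.mem_coe, mem_LamPerp_iff]
    simp
  rw [h]
  refine isClosed_biInter fun y _ => isClosed_eq ?_ continuous_const
  exact Circle.exp.continuous.comp (continuous_const.mul
    (D.continuous_pairing.comp (continuous_id.prodMk continuous_const)))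

lemma isOpenMap_dualHom : IsOpenMap D.dualHom := by
  have h1 : SigmaCompactSpace D.LamPerp :=
    D.isClosed_LamPerp.isClosedEmbedding_subtypeVal.sigmaCompactSpace
  have h2 : SigmaCompactSpace (Multiplicative D.LamPerp) := h1
  -- the dual of a locally compact group is locally compact, hence a Baire space, and the open
  -- mapping theorem applies
  have := D.locallyCompactSpace_C
  exact D.dualHom.isOpenMap_of_sigmaCompact D.dualHom_surjective D.continuous_dualHom

/-- The dual logarithm `ℒ*` as an isomorphism of topological groups. -/
def dualLogEquiv : PontryaginDual (C m) ≃ₜ* Multiplicative D.LamPerpQuot where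
  __ := quotientMulEquiv (D.ZEll.addSubgroupOf D.LamPerp) D.dualHom D.dualHom_surjective
    D.dualHom_eq_one_iff
  continuous_toFun := continuous_quotientMulEquiv_of_isOpenMap (D.ZEll.addSubgroupOf D.LamPerp)
    D.dualHom D.dualHom_surjective D.dualHom_eq_one_iff D.continuous_dualHom D.isOpenMap_dualHom
  continuous_invFun := continuous_quotientMulEquiv_symm (D.ZEll.addSubgroupOf D.LamPerp)
    D.dualHom D.dualHom_surjective D.dualHom_eq_one_iff D.continuous_dualHom

lemma dualLogEquiv_eq_iff (χ : PontryaginDual (C m)) (w : D.LamPerp) :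
    D.dualLogEquiv χ = Multiplicative.ofAdd (QuotientAddGroup.mk w) ↔
      ∀ y, χ (D.expC y) = D.pairChar w y := by
  rw [← dualChar_eq_iff]
  exact quotientMulEquiv_eq_iff (D.ZEll.addSubgroupOf D.LamPerp) D.dualHom D.dualHom_surjective
    D.dualHom_eq_one_iff χ w

end LogData

/-! ### Parameters of characters -/

lemma infEmb_mul (σ : InfinitePlace F) (z z' : (σ.Completion)ˣ) :
    infEmb σ (z * z') = infEmb σ z * infEmb σ z' := by
  classical
  refine Units.ext (Prod.ext ?_ (mul_one _).symm)
  exact Pi.mulSingle_mul (f := fun τ : InfinitePlace F => τ.Completion) σ _ _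

lemma coe_arg_circle_exp (t : ℝ) :
    ((Complex.arg (Circle.exp (2 * Real.pi * t)) / (2 * Real.pi) : ℝ) : UnitAddCircle) = t := by
  have h := coe_arg_exp 0 t
  rwa [Complex.ofReal_zero, zero_add, ← Circle.coe_exp] at h

lemma coe_circle_exp_log {x : ℝ} (hx : 0 < x) (φ c : ℝ) :
    (Circle.exp (2 * Real.pi * (φ * (c / (2 * Real.pi) * Real.log x))) : ℂ) =
      (x : ℂ) ^ (c * Complex.I * φ) := by
  have hpi := Real.pi_pos
  rw [Circle.coe_exp, Complex.cpow_def_of_ne_zero (by exact_mod_cast hx.ne'),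
    ← Complex.ofReal_log hx.le,
    show 2 * Real.pi * (φ * (c / (2 * Real.pi) * Real.log x)) = φ * (c * Real.log x) by field_simp]
  congr 1
  push_cast
  ring

lemma eq_of_forall_exp_eq {a b : ℝ}
    (h : ∀ t : ℝ, Complex.exp (Complex.I * a * t) = Complex.exp (Complex.I * b * t)) : a = b := by
  refine sub_eq_zero.1 (eq_zero_of_forall_int fun t => ?_)
  rw [← circle_exp_two_pi_eq_one_iff]
  refine Circle.ext ?_
  have h1 := h (2 * Real.pi * t)
  rw [Circle.coe_exp, Circle.coe_one]
  rw [← div_eq_one_iff_eq (Complex.exp_ne_zero _), ← Complex.exp_sub] at h1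
  rw [← h1]
  congr 1
  push_cast
  ring

lemma exists_int_sub_of_coe_eq {a b : ℝ} (h : (a : UnitAddCircle) = b) :
    ∃ k : ℤ, (k : ℝ) = a - b := by
  rw [← sub_eq_zero, ← AddCircle.coe_sub, AddCircle.coe_eq_zero_iff] at h
  obtain ⟨k, hk⟩ := h
  exact ⟨k, by rw [← hk, zsmul_one]⟩

lemma char_mul {m : Modulus F} (χ : PontryaginDual (C m)) (a b : C m) : χ (a * b) = χ a * χ b :=
  map_mul (show C m →ₜ* Circle from χ) a b

namespace LogData

variable {m : Modulus F} (D : LogData m)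

lemma valued_finComp_infEmb (σ : InfinitePlace F) (z : (σ.Completion)ˣ) (p : Primes F) :
    Valued.v (finComp p (infEmb σ z) : p.adicCompletion F) = 1 := by
  rw [finComp_infEmb]; simp

lemma residue_infEmb (σ : InfinitePlace F) (z : (σ.Completion)ˣ)
    (hz : ∀ h : σ.IsReal, 0 < InfinitePlace.Completion.extensionEmbeddingOfIsReal h z) :
    D.residue (infEmb σ z) = 1 := by
  refine (D.residue_eq_one_iff_of_units (valued_finComp_infEmb σ z)).2
    ⟨fun p => ?_, fun τ _ => ?_⟩
  · rw [finComp_infEmb]; simp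
  · by_cases h : τ.1 = σ
    · subst h
      rw [realComp_of_infComp τ (infComp_infEmb_self _ _)]
      exact hz τ.2
    · rw [realComp_of_infComp τ (infComp_infEmb_of_ne h _)]
      simp

open scoped Classical in
lemma archLog_infEmb_fst (σ : InfinitePlace F) (z : (σ.Completion)ˣ) :
    (archLog (infEmb σ z)).1 =
      Pi.single σ ((σ.mult : ℝ) / (2 * Real.pi) * Real.log ‖(z : σ.Completion)‖) := by
  funext τ
  by_cases h : τ = σ
  · subst h
    rw [Pi.single_eq_same, archLog]
    simp only [infComp_infEmb_self]
  · rw [Pi.single_eq_of_ne h, archLog]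
    simp only [infComp_infEmb_of_ne h]
    simp

open scoped Classical in
lemma archLog_infEmb_snd (σ : InfinitePlace F) (z : (σ.Completion)ˣ) (τ : ComplexPlace F) :
    (archLog (infEmb σ z)).2 τ = if τ.1 = σ then
      Complex.arg (InfinitePlace.Completion.extensionEmbedding σ z) / (2 * Real.pi) else 0 := by
  change Complex.arg (complexComp τ (infEmb σ z) : ℂ) / _ = _
  split_ifs with h
  · subst h
    rw [complexComp_of_infComp τ (infComp_infEmb_self _ _)]
  · rw [complexComp_of_infComp τ (infComp_infEmb_of_ne h _)]
    simp

variable {D} {χ : PontryaginDual (C m)} {w : D.V}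

lemma char_mk (h : ∀ y, χ (D.expC y) = D.pairChar w y) {x : Ideles F} {y : D.M} (hx : x ∈ D.US)
    (hy : D.logS x = Multiplicative.ofAdd (D.proj y)) :
    χ (C.mk m x) = Circle.exp (2 * Real.pi * D.pairing w y) := by
  rw [← D.expC_eq hx hy, h]; rfl

lemma char_infEmb (h : ∀ y, χ (D.expC y) = D.pairChar w y) (σ : InfinitePlace F)
    (z : (σ.Completion)ˣ)
    (hz : ∀ h : σ.IsReal, 0 < InfinitePlace.Completion.extensionEmbeddingOfIsReal h z) :
    χ (C.mk m (infEmb σ z)) =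
      Circle.exp (2 * Real.pi * D.pairing w (0, archLog (infEmb σ z))) := by
  rw [← D.expC_archLog (valued_finComp_infEmb σ z) (D.residue_infEmb σ z hz), h]; rfl

lemma char_real_pos (h : ∀ y, χ (D.expC y) = D.pairChar w y) (σ : RealPlace F)
    (z : (σ.1.Completion)ˣ)
    (hz : 0 < InfinitePlace.Completion.extensionEmbeddingOfIsReal σ.2 z) :
    (χ (C.mk m (infEmb σ.1 z)) : ℂ) =
      (InfinitePlace.Completion.extensionEmbeddingOfIsReal σ.2 z : ℂ) ^
        (Complex.I * w.2.1 σ.1) := by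
  classical
  rw [char_infEmb h σ.1 z fun _ => hz]
  have h1 : archLog (infEmb σ.1 z) = (Pi.single σ.1 (((1 : ℝ) / (2 * Real.pi) * Real.log
      (InfinitePlace.Completion.extensionEmbeddingOfIsReal σ.2 z))), 0) := by
    refine Prod.ext ?_ (funext fun τ => ?_)
    · rw [archLog_infEmb_fst, InfinitePlace.mult_isReal σ, ← infComp_infEmb_self σ.1 z,
        norm_infComp_real, realComp_of_infComp σ rfl, infComp_infEmb_self, abs_of_pos hz,
        Nat.cast_one]
    · rw [archLog_infEmb_snd, if_neg]
      · rfl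
      · intro h'
        exact InfinitePlace.not_isReal_iff_isComplex.2 τ.2 (h' ▸ σ.2)
  rw [h1, pairing_single_place, coe_circle_exp_log hz]
  simp

lemma isRealParam (h : ∀ y, χ (D.expC y) = D.pairChar w y) (σ : RealPlace F) :
    IsRealParam χ σ (w.2.1 σ.1) := by
  have h1 : (χ (C.mk m (infEmb σ.1 (-1))) : ℂ) = 1 ∨ (χ (C.mk m (infEmb σ.1 (-1))) : ℂ) = -1 := by
    rw [← sq_eq_one_iff, ← Circle.coe_pow, sq, ← char_mul]
    have h2 := infEmb_mul σ.1 (-1) (-1)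
    rw [neg_mul_neg, one_mul] at h2
    have h3 : (χ (C.mk m (infEmb σ.1 1)) : ℂ) = 1 := by
      rw [char_real_pos h σ 1 (by simp)]
      simp
    rw [h2] at h3
    exact h3
  obtain ⟨k, hk1, hk⟩ : ∃ k : ℕ, k ≤ 1 ∧ (χ (C.mk m (infEmb σ.1 (-1))) : ℂ) = (-1) ^ k := by
    rcases h1 with h1 | h1
    · exact ⟨0, by simp [h1]⟩
    · exact ⟨1, by simp [h1]⟩
  refine ⟨k, hk1, fun z => ?_⟩
  have hz0 : InfinitePlace.Completion.extensionEmbeddingOfIsReal σ.2 z ≠ 0 := by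
    rw [map_ne_zero]; exact z.ne_zero
  rcases hz0.lt_or_gt with hz | hz
  · have hz' : 0 < InfinitePlace.Completion.extensionEmbeddingOfIsReal σ.2
        ((-z : (σ.1.Completion)ˣ) : σ.1.Completion) := by
      rw [Units.val_neg, map_neg]; linarith
    have h3 := infEmb_mul σ.1 (-1) (-z)
    rw [neg_mul_neg, one_mul] at h3
    have h4 : χ (C.mk m (infEmb σ.1 z)) =
        χ (C.mk m (infEmb σ.1 (-1))) * χ (C.mk m (infEmb σ.1 (-z))) := by
      rw [h3]
      exact char_mul χ (C.mk m (infEmb σ.1 (-1))) (C.mk m (infEmb σ.1 (-z)))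
    rw [h4, Circle.coe_mul, char_real_pos h σ _ hz', hk]
    simp only [sign_neg hz, abs_of_neg hz, Units.val_neg, map_neg]
    norm_num
  · rw [char_real_pos h σ z hz]
    simp [sign_pos hz, abs_of_pos hz]

/-- The coordinates of `Λ^⊥` at the complex places are integers because `Λ` contains `ℤ^{r₂}`. -/
lemma exists_int_eq_of_mem_LamPerp (hw : w ∈ D.LamPerp) (σ : ComplexPlace F) :
    ∃ k : ℤ, w.2.2 σ = k := by
  classical
  have h1 : ((0, (0, Pi.single σ 1)) : D.M) ∈ D.Lam := by
    refine D.mem_Lam.2 ⟨1, by rw [map_one]; exact one_mem _, ?_⟩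
    have h2 := (D.mem_torsionLattice_iff 0 (Pi.single σ 1)).1
      ⟨zero_mem _, Pi.single σ 1, funext fun τ => ?_⟩
    · rw [map_one, map_one]
      exact (congrArg Multiplicative.ofAdd h2).symm
    · by_cases h : τ = σ
      · subst h; simp
      · simp [h]
  obtain ⟨k, hk⟩ := hw _ h1
  rw [pairing_single_complexPlace, mul_one] at hk
  exact ⟨k, hk⟩

lemma isComplexParam (h : ∀ y, χ (D.expC y) = D.pairChar w y) (σ : ComplexPlace F) {k : ℤ}
    (hk : w.2.2 σ = k) : IsComplexParam χ σ k (w.2.1 σ.1) := by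
  classical
  intro z
  have hpi := Real.pi_pos
  set x := InfinitePlace.Completion.extensionEmbedding σ.1 (z : σ.1.Completion) with hx
  have hx0 : x ≠ 0 := by rw [hx, map_ne_zero]; exact z.ne_zero
  have hnorm : ‖(z : σ.1.Completion)‖ = ‖x‖ := by
    rw [← infComp_infEmb_self σ.1 z, norm_infComp_complex, complexComp_of_infComp σ rfl,
      infComp_infEmb_self]
  rw [char_infEmb h σ.1 z fun h => absurd h (InfinitePlace.not_isReal_iff_isComplex.2 σ.2)]
  have h1 : ((0, archLog (infEmb σ.1 z)) : D.M) =
      (0, (Pi.single σ.1 (((2 : ℝ) / (2 * Real.pi) * Real.log ‖x‖)), 0)) +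
        (0, (0, Pi.single σ (Complex.arg x / (2 * Real.pi)))) := by
    refine Prod.ext (add_zero _).symm (Prod.ext ?_ (funext fun τ => ?_))
    · change (archLog _).1 = Pi.single σ.1 _ + 0
      rw [add_zero, archLog_infEmb_fst, InfinitePlace.mult_isComplex σ, hnorm]
      simp
    · change (archLog _).2 τ = (0 : ComplexPlace F → ℝ) τ +
        (Pi.single σ _ : ComplexPlace F → ℝ) τ
      rw [Pi.zero_apply, zero_add, archLog_infEmb_snd, Pi.single_apply]
      simp only [Subtype.ext_iff, hx]
  rw [h1, pairing_add_right, mul_add, Circle.exp_add, Circle.coe_mul, pairing_single_place,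
    pairing_single_complexPlace, coe_circle_exp_log (norm_pos_iff.2 hx0), mul_comm, hk]
  congr 1
  · rw [Circle.coe_exp]
    have h2 : x / (‖x‖ : ℂ) = Complex.exp (Complex.arg x * Complex.I) := by
      have h3 : (‖x‖ : ℂ) ≠ 0 := by exact_mod_cast norm_ne_zero_iff.2 hx0
      rw [div_eq_iff h3, mul_comm, Complex.norm_mul_exp_arg_mul_I]
    rw [h2, ← Complex.exp_int_mul,
      show 2 * Real.pi * (k * (Complex.arg x / (2 * Real.pi))) = k * Complex.arg x by field_simp]
    congr 1
    push_cast
    ring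

lemma isDualLog (h : ∀ y, χ (D.expC y) = D.pairChar w y) (hw : w ∈ D.LamPerp) :
    D.IsDualLog χ w where
  prime p := by
    classical
    rw [char_mk h (D.finEmb_mem_US p _) (D.logS_finEmb_unif p), pairing_single_prime,
      coe_arg_circle_exp]
  modulus i := by
    obtain ⟨u, hu⟩ := D.exists_represents (D.logMod.symm (Multiplicative.ofAdd
      (QuotientAddGroup.mk (Pi.single i (1 : ℤ)) : (Fin D.r → ℤ) ⧸ D.relations)))
    refine ⟨u, hu, ?_⟩
    have h1 : D.logS u = Multiplicative.ofAdd (D.proj ((0, Pi.single i 1), 0)) := by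
      rw [hu.logS, MulEquiv.apply_symm_apply]
      refine congrArg Multiplicative.ofAdd (Prod.ext rfl (Prod.ext rfl ?_))
      funext σ
      simp [proj]
    rw [char_mk h hu.mem_US h1, pairing_single_modulus, coe_arg_circle_exp]
  real σ := isRealParam h σ
  complex σ := by
    obtain ⟨k, hk⟩ := exists_int_eq_of_mem_LamPerp hw σ
    exact ⟨k, hk, isComplexParam h σ hk⟩

lemma IsRealParam.unique {σ : RealPlace F} {φ φ' : ℝ} (h : IsRealParam χ σ φ)
    (h' : IsRealParam χ σ φ') : φ = φ' := by
  obtain ⟨k, -, hk⟩ := h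
  obtain ⟨k', -, hk'⟩ := h'
  refine eq_of_forall_exp_eq fun t => ?_
  obtain ⟨z, hz⟩ := InfinitePlace.Completion.surjective_extensionEmbeddingOfIsReal σ.2 (Real.exp t)
  have hz0 : z ≠ 0 := by
    rintro rfl
    rw [map_zero] at hz
    exact (Real.exp_pos t).ne hz
  have h1 := (hk (Units.mk0 z hz0)).symm.trans (hk' (Units.mk0 z hz0))
  have h2 : ∀ a : ℝ,
      ((Real.exp t : ℝ) : ℂ) ^ (Complex.I * a) = Complex.exp (Complex.I * a * t) := by
    intro a
    rw [Complex.cpow_def_of_ne_zero (by exact_mod_cast (Real.exp_pos t).ne'), ← Complex.ofReal_log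
      (Real.exp_pos t).le, Real.log_exp, mul_comm]
  simpa only [Units.val_mk0, hz, sign_pos (Real.exp_pos t), abs_of_pos (Real.exp_pos t), h2,
    SignType.coe_one, Complex.ofReal_one, one_pow, one_mul] using h1

lemma IsComplexParam.unique {σ : ComplexPlace F} {k k' : ℤ} {φ φ' : ℝ}
    (h : IsComplexParam χ σ k φ) (h' : IsComplexParam χ σ k' φ') : k = k' ∧ φ = φ' := by
  have key : ∀ x : ℂ, x ≠ 0 → (x / (‖x‖ : ℂ)) ^ k * (‖x‖ : ℂ) ^ (2 * Complex.I * φ) =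
      (x / (‖x‖ : ℂ)) ^ k' * (‖x‖ : ℂ) ^ (2 * Complex.I * φ') := by
    intro x hx
    obtain ⟨z, rfl⟩ := InfinitePlace.Completion.surjective_extensionEmbedding_of_isComplex σ.2 x
    have hz0 : z ≠ 0 := by
      rintro rfl
      exact hx (map_zero _)
    exact (h (Units.mk0 z hz0)).symm.trans (h' (Units.mk0 z hz0))
  constructor
  · have h1 : (k : ℝ) = k' := by
      refine eq_of_forall_exp_eq fun t => ?_
      have h2 := key (Complex.exp (t * Complex.I)) (Complex.exp_ne_zero _)
      rw [Complex.norm_exp_ofReal_mul_I] at h2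
      simp only [Complex.ofReal_one, div_one, Complex.one_cpow, mul_one,
        ← Complex.exp_int_mul] at h2
      convert h2 using 2 <;> push_cast <;> ring
    exact_mod_cast h1
  · refine eq_of_forall_exp_eq fun t => ?_
    have hpos := Real.exp_pos (t / 2)
    have h2 := key ((Real.exp (t / 2) : ℝ) : ℂ) (by exact_mod_cast hpos.ne')
    have h3 : ((Real.exp (t / 2) : ℝ) : ℂ) ≠ 0 := by exact_mod_cast hpos.ne'
    rw [Complex.norm_of_nonneg hpos.le, div_self h3, one_zpow, one_zpow, one_mul, one_mul,
      Complex.cpow_def_of_ne_zero h3, Complex.cpow_def_of_ne_zero h3, ← Complex.ofReal_log hpos.le,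
      Real.log_exp] at h2
    convert h2 using 2 <;> push_cast <;> ring

lemma IsDualLog.sub_mem {w' : D.V} (h : D.IsDualLog χ w) (h' : D.IsDualLog χ w') :
    w - w' ∈ D.ZEll := by
  have h1 : ∀ p, ∃ k : ℤ, (k : ℝ) = w.1.1 p - w'.1.1 p := fun p =>
    exists_int_sub_of_coe_eq ((h.prime p).trans (h'.prime p).symm)
  have h2 : ∀ i, ∃ k : ℤ, (k : ℝ) = w.1.2 i - w'.1.2 i := fun i => by
    obtain ⟨u, hu, hχ⟩ := h.modulus i
    obtain ⟨u', hu', hχ'⟩ := h'.modulus i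
    refine exists_int_sub_of_coe_eq (hχ.trans (Eq.trans ?_ hχ'.symm))
    rw [D.mk_eq_mk_of_logS_eq hu.mem_US hu'.mem_US (hu.logS.trans hu'.logS.symm)]
  choose a ha using h1
  choose b hb using h2
  refine ⟨⟨(a, b), Prod.ext (funext ha) (funext hb)⟩, Prod.ext (funext fun σ => ?_)
    (funext fun σ => ?_)⟩
  · refine sub_eq_zero.2 ?_
    rcases σ.isReal_or_isComplex with hσ | hσ
    · exact (h.real ⟨σ, hσ⟩).unique (h'.real ⟨σ, hσ⟩)
    · obtain ⟨k, -, hk⟩ := h.complex ⟨σ, hσ⟩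
      obtain ⟨k', -, hk'⟩ := h'.complex ⟨σ, hσ⟩
      exact (hk.unique hk').2
  · obtain ⟨k, hk0, hk⟩ := h.complex σ
    obtain ⟨k', hk0', hk'⟩ := h'.complex σ
    refine sub_eq_zero.2 (hk0.trans (Eq.trans ?_ hk0'.symm))
    rw [(hk.unique hk').1]

/-- The vectors `w` representing the dual logarithm of `χ` are those with `χ(x) = exp (2πi w·ℒ(x))`.
Such a vector exists and represents the dual logarithm, and the dual logarithm is unique modulo
`ℤ^ℓ`. -/
lemma isDualLog_iff : D.IsDualLog χ w ↔ w ∈ D.LamPerp ∧ ∀ y, χ (D.expC y) = D.pairChar w y := by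
  refine ⟨fun h => ?_, fun ⟨hw, h⟩ => isDualLog h hw⟩
  obtain ⟨w', hw'⟩ := D.dualHom_surjective χ
  have h1 := (D.dualChar_eq_iff w'.toAdd χ).1 hw'
  have h2 := h.sub_mem (isDualLog h1 w'.toAdd.2)
  have h3 : w = (w - w'.toAdd) + w'.toAdd := by abel
  refine ⟨?_, fun y => ?_⟩
  · rw [h3]
    exact add_mem (D.ZEll_le_LamPerp h2) w'.toAdd.2
  · rw [h1, h3, pairChar_add, (D.pairChar_eq_one_iff _).2 h2, one_mul]

end LogData

/-! ### Existence of the choices -/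

/-- Ideals factor into primes, so the prime ideals generate the class group. -/
lemma mk0_mem_closure_range_primeClass {I : Ideal (𝓞 F)} (hI : I ≠ 0) :
    ClassGroup.mk0 ⟨I, mem_nonZeroDivisors_of_ne_zero hI⟩ ∈
      Subgroup.closure (Set.range (primeClass (F := F))) := by
  induction I using UniqueFactorizationMonoid.induction_on_prime with
  | h₁ => exact absurd rfl hI
  | h₂ J hJ =>
    have h : (⟨J, mem_nonZeroDivisors_of_ne_zero hI⟩ : nonZeroDivisors (Ideal (𝓞 F))) = 1 :=
      Subtype.ext ((Ideal.isUnit_iff.1 hJ).trans Ideal.one_eq_top.symm)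
    rw [h, map_one]
    exact one_mem _
  | h₃ J P hJ hP ih =>
    have h : (⟨P * J, mem_nonZeroDivisors_of_ne_zero hI⟩ : nonZeroDivisors (Ideal (𝓞 F))) =
      ⟨P, mem_nonZeroDivisors_of_ne_zero hP.ne_zero⟩ * ⟨J, mem_nonZeroDivisors_of_ne_zero hJ⟩ :=
      Subtype.ext rfl
    rw [h, map_mul]
    exact mul_mem (Subgroup.subset_closure
      ⟨⟨P, Ideal.isPrime_of_prime hP, hP.ne_zero⟩, rfl⟩) (ih hJ)

lemma closure_range_primeClass :
    Subgroup.closure (Set.range (primeClass (F := F))) = ⊤ := by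
  refine (Subgroup.eq_top_iff' _).2 fun c => ?_
  obtain ⟨I, rfl⟩ := ClassGroup.mk0_surjective c
  exact mk0_mem_closure_range_primeClass (nonZeroDivisors.coe_ne_zero I)

lemma exists_finset_primeClass_closure_eq_top : ∃ S : Finset (Primes F),
    Subgroup.closure (primeClass '' (S : Set (Primes F))) = ⊤ := by
  classical
  have hfin := Set.toFinite (Set.range (primeClass (F := F)))
  obtain ⟨S, -, hS⟩ := Finset.subset_set_image_iff.1
    (show (hfin.toFinset : Set (ClassGroup (𝓞 F))) ⊆ primeClass '' Set.univ by
      rw [Set.Finite.coe_toFinset, Set.image_univ])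
  refine ⟨S, ?_⟩
  rw [← Finset.coe_image, hS, Set.Finite.coe_toFinset, closure_range_primeClass]

lemma exists_ord_eq_one (p : Primes F) : ∃ z : (p.adicCompletion F)ˣ, ord p z = 1 := by
  obtain ⟨a, ha⟩ := p.valuation_exists_uniformizer F
  have h : Valued.v (a : p.adicCompletion F) = WithZero.exp (-1 : ℤ) := by
    rw [HeightOneSpectrum.valuedAdicCompletion_eq_valuation', ha]
  have h0 : (a : p.adicCompletion F) ≠ 0 := by
    rw [← Valuation.ne_zero_iff Valued.v, h]
    exact WithZero.exp_ne_zero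
  refine ⟨Units.mk0 _ h0, ?_⟩
  rw [ord, Units.val_mk0, h, WithZero.log_exp, neg_neg]

instance finite_unitsMod (m : Modulus F) : Finite (UnitsMod m) := by
  have := Ideal.finiteQuotientOfFreeOfNeBot m.fin m.fin_ne_bot
  infer_instance

/-- A finite commutative group is a quotient of `ℤ^r` by a subgroup of finite index. -/
lemma exists_mulEquiv_quotient_of_finite (G : Type*) [CommGroup G] [Finite G] :
    ∃ (r : ℕ) (N : AddSubgroup (Fin r → ℤ)),
      N.FiniteIndex ∧ Nonempty (G ≃* Multiplicative ((Fin r → ℤ) ⧸ N)) := by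
  classical
  obtain ⟨r, ⟨e⟩⟩ := Finite.exists_equiv_fin G
  let f : Multiplicative (Fin r → ℤ) →* G :=
    { toFun := fun a => ∏ i, e.symm i ^ a.toAdd i
      map_one' := by simp
      map_mul' := fun a b => by simp [zpow_add, Finset.prod_mul_distrib] }
  have hf : Function.Surjective f := fun g =>
    ⟨Multiplicative.ofAdd (Pi.single (e g) 1), by
      change ∏ i, e.symm i ^ (Pi.single (e g) 1 : Fin r → ℤ) i = g
      rw [Finset.prod_eq_single (e g) (fun i _ hi => by simp [Pi.single_eq_of_ne hi])
        (fun h => absurd (Finset.mem_univ _) h)]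
      simp⟩
  let N : AddSubgroup (Fin r → ℤ) := Subgroup.toAddSubgroup' f.ker
  let φ := quotientMulEquiv N f hf fun _ => Iff.rfl
  have : Finite ((Fin r → ℤ) ⧸ N) := Finite.of_equiv G (φ.toEquiv.trans Multiplicative.toAdd)
  exact ⟨r, N, AddSubgroup.finiteIndex_of_finite_quotient, ⟨φ⟩⟩

lemma nonempty_logData (m : Modulus F) : Nonempty (LogData m) := by
  obtain ⟨S, hS⟩ := exists_finset_primeClass_closure_eq_top (F := F)
  choose unif hunif using exists_ord_eq_one (F := F)
  obtain ⟨r, N, hN, ⟨φ⟩⟩ := exists_mulEquiv_quotient_of_finite (UnitsMod m)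
  exact ⟨⟨S, hS, unif, hunif, r, N, hN, φ⟩⟩

end HeckeLog

end

theorem mainTheorem1 (F : Type*) [Field F] [NumberField F] (m : HeckeLog.Modulus F) :
    Nonempty (HeckeLog.LogData m) ∧
    ∀ D : HeckeLog.LogData m,
      (DiscreteTopology D.Lam ∧ Module.Free ℤ D.Lam ∧ Module.Finite ℤ D.Lam ∧
        Module.finrank ℤ D.Lam = D.ell + Module.finrank ℚ F - 1) ∧
      (∀ x : HeckeLog.Ideles F, ∃ α : Fˣ, x * (HeckeLog.principal α)⁻¹ ∈ D.US) ∧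
      ∃ (L : HeckeLog.C m ≃ₜ* Multiplicative (D.M ⧸ D.Lam))
        (Ldual : PontryaginDual (HeckeLog.C m) ≃ₜ* Multiplicative D.LamPerpQuot),
        (∀ (x : HeckeLog.Ideles F) (α : Fˣ) (y : D.M),
          x * (HeckeLog.principal α)⁻¹ ∈ D.US →
          D.logS (x * (HeckeLog.principal α)⁻¹) = Multiplicative.ofAdd (D.proj y) →
          L (HeckeLog.C.mk m x) = Multiplicative.ofAdd (QuotientAddGroup.mk y)) ∧
        (∀ (χ : PontryaginDual (HeckeLog.C m)) (w : D.V),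
          D.IsDualLog χ w ↔ ∃ hw : w ∈ D.LamPerp,
            Ldual χ = Multiplicative.ofAdd (QuotientAddGroup.mk ⟨w, hw⟩)) ∧
        (∀ (χ : PontryaginDual (HeckeLog.C m)) (x : HeckeLog.Ideles F) (w : D.LamPerp) (y : D.M),
          Ldual χ = Multiplicative.ofAdd (QuotientAddGroup.mk w) →
          L (HeckeLog.C.mk m x) = Multiplicative.ofAdd (QuotientAddGroup.mk y) →
          (χ (HeckeLog.C.mk m x) : ℂ) =
            Complex.exp (2 * Complex.I * Real.pi * (D.pairing w y : ℝ))) := by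
  refine ⟨HeckeLog.nonempty_logData m, fun D => ⟨⟨D.discreteTopology_Lam, D.free_Lam,
    D.finite_and_finrank_Lam⟩, D.exists_mul_principal_inv_mem_US, D.logEquiv, D.dualLogEquiv,
    fun x α y hx hy => ?_, fun χ w => ?_, fun χ x w y hw hy => ?_⟩⟩
  · rw [D.logEquiv_eq_iff, D.expC_eq hx hy, HeckeLog.mk_mul_principal_inv]
  · rw [HeckeLog.LogData.isDualLog_iff, ← exists_prop]
    exact exists_congr fun hw => (D.dualLogEquiv_eq_iff χ ⟨w, hw⟩).symm
  · rw [D.logEquiv_eq_iff] at hy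
    rw [← hy, (D.dualLogEquiv_eq_iff χ w).1 hw]
    change (Circle.exp (2 * Real.pi * D.pairing w y) : ℂ) = _
    rw [Circle.coe_exp]
    congr 1
    push_cast
    ring
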